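/- All graphs are finite and loopless; multiple edges are allowed. A graph is $m$-tree-connected ($m\ge 1$ an integer) if it has $m$ pairwise edge-disjoint spanning trees; the graph with no vertices is not $m$-tree-connected. The vertex set of every graph $G$ is uniquely partitioned into the maximal sets of vertices that induce $m$-tree-connected subgraphs; with $P$ this partition and $e_G(P)$ the number of edges of $G$ whose ends lie in different parts of $P$, let $\Omega_m(G)=|P|-\frac1m e_G(P)$ (so $\Omega_m=0$ for the graph with no vertices). Write $d_G(v)$ for the degree of $v$ in $G$, $e_G(S)$ for the number of edges of $G$ with both ends in $S$, and $G\setminus S$ for the graph obtained from $G$ by removing the vertices of $S$. **Theorem.** Let $m\ge 1$ be an integer, let $G$ be an $m$-tree-connected graph, let $X\subseteq V(G)$, and let $F$ be a spanning subgraph of $G$. Let $\lambda\in[0,1/m]$ be a real number and let $\eta:X\to\left(m\lambda+\frac{m-1}{m},\infty\right)$ be a real function. If for all $S\subseteq X$ $$\Omega_m(G\setminus S)<\frac1m+\sum_{v\in S}\bigl(\eta(v)-2\bigr)+2-\lambda\bigl(e_G(S)+m\bigr),$$ then $G$ has an $m$-tree-connected spanning subgraph $H$ containing $F$ such that for each $v\in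 X$ $$d_H(v)\le\bigl\lceil m\eta(v)-m^2\lambda\bigr\rceil+\max\{0,d_F(v)-m\}.$$ -/

import Mathlib

open scoped Graph

namespace Graph

/-- A (multi)graph is connected if it has a vertex and any two of its vertices are joined by a
walk. -/
def IsConnected {α β : Type*} (G : Graph α β) : Prop :=
  V(G).Nonempty ∧ ∀ x ∈ V(G), ∀ y ∈ V(G), Relation.ReflTransGen G.Adj x y

/-- A (multi)graph has a cycle if, for some `n`, there are `n + 1` distinct vertices and `n + 1`
distinct edges such that the `i`-th edge joins the `i`-th vertex to the cyclically next one (the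
addition in `Fin (n + 1)` is cyclic). The case `n = 0` is a loop, the case `n = 1` a pair of
parallel edges. -/
def HasCycle {α β : Type*} (G : Graph α β) : Prop :=
  ∃ (n : ℕ) (v : Fin (n + 1) → α) (e : Fin (n + 1) → β),
    Function.Injective v ∧ Function.Injective e ∧ ∀ i, G.IsLink (e i) (v i) (v (i + 1))

/-- A tree is a connected graph without cycles. -/
def IsTree {α β : Type*} (G : Graph α β) : Prop :=
  G.IsConnected ∧ ¬ G.HasCycle

/-- `G` is `m`-tree-connected (`m ≥ 1`): it has `m` pairwise edge-disjoint spanning trees. -/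
def IsTreeConnected {α β : Type*} (m : ℕ) (G : Graph α β) : Prop :=
  ∃ T : Fin m → Graph α β,
    (∀ i, T i ≤s G ∧ (T i).IsTree) ∧ ∀ i j, i ≠ j → Disjoint E(T i) E(T j)

/-- The vertex sets of the `m`-tree-connected components of `G`: the inclusion-maximal sets of
vertices that induce an `m`-tree-connected subgraph. -/
def treeComponents {α β : Type*} (m : ℕ) (G : Graph α β) : Set (Set α) :=
  {A | Maximal (fun B : Set α => B ⊆ V(G) ∧ (G.induce B).IsTreeConnected m) A}

/-- The edges of `G` whose ends lie in different members of the family `P` of vertex sets. -/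
def crossingEdges {α β : Type*} (G : Graph α β) (P : Set (Set α)) : Set β :=
  {e | ∃ x y, G.IsLink e x y ∧ ∃ A ∈ P, ∃ B ∈ P, A ≠ B ∧ x ∈ A ∧ y ∈ B}

/-- The tree-connectivity measure `Ω_m(G) = |P| - e_G(P) / m`, where `P` is the partition of the
vertex set into the `m`-tree-connected components (for finite graphs and `m ≥ 1`). -/
noncomputable def treeMeasure {α β : Type*} (m : ℕ) (G : Graph α β) : ℝ :=
  ((treeComponents m G).ncard : ℝ) - 1 / (m : ℝ) * ((G.crossingEdges (treeComponents m G)).ncard : ℝ)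

/-- The degree of a vertex: the number of edges incident with it (for finite loopless graphs). -/
noncomputable def deg {α β : Type*} (G : Graph α β) (v : α) : ℕ :=
  (G.incidenceSet v).ncard

/-- `e_G(S)`: the number of edges of `G` with both ends in `S` (for finite graphs). -/
noncomputable def numEdgesInside {α β : Type*} (G : Graph α β) (S : Set α) : ℕ :=
  {e | ∃ x ∈ S, ∃ y ∈ S, G.IsLink e x y}.ncard

end Graph

open scoped Graph

set_option linter.unusedSectionVars false

namespace EdgeSparsity

open Finset

variable {α β : Type*} [DecidableEq α] [DecidableEq β]
variable {φ : β → α × α} {m : ℕ} {D E F I J K T T' : Finset β}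
variable {A B C S S₀ S₁ V W X : Finset α} {e f g : β} {v w x y z : α} {G H : Graph α β}

/-! The `m`-sparse edge sets are the independent sets of the union of `m` cycle matroids: by the
exchange argument of `Sparse.exists_forestPacking` such a set splits into `m` forests, and by
counting each forest spans every tight set. So a graph is `m`-tree-connected exactly when some
sparse set of its edges makes the whole vertex set tight, and `m * Ω_m` is `m * |V|` minus the size
of a maximal sparse edge set (`ListsEnds.mul_treeMeasure_eq`). The theorem thus becomes a statement
about bases and ranks.

Replace `F` by a maximal sparse subset `F₀` and look for a base `T ⊇ F₀` obeying the degree bounds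
written with `d_{F₀}`; then `H = T ∪ F` works (`degree_union_le`). If there is none, take `T` of
least total excess. Start from the overloaded vertices and keep adding each vertex of `X` whose
degree cannot be pushed below its bound by changing `T` only inside a tight set and away from the
vertices collected so far. This stabilises at a set `S`. An edge avoiding `S` must be spanned by the
edges of `T` that avoid `S` or lie in `F₀`: otherwise both its ends could be relieved and the edge
exchanged for one at a collected vertex `w` (`exists_improvement`). That would lower the total
excess, or contradict the reason for collecting `w` (`joined_keep_barrier`).

Such a barrier bounds the rank of `G \ S`, even after edges of `F₀` are added to it
(`IsBaseOver.card_add_le`). As the degrees of `T` on `S` reach their bounds and one exceeds them,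
`Ω_m(G \ S)` is too large for the hypothesis (`barrier_inequality_absurd`). -/

/-- The edges of `I` with both ends in `A`, where `φ e` is the pair of ends of `e`. -/
def inside (φ : β → α × α) (I : Finset β) (A : Finset α) : Finset β :=
  I.filter fun e => (φ e).1 ∈ A ∧ (φ e).2 ∈ A

/-- `I` is `m`-sparse: every nonempty vertex set `A` spans at most `m (|A| - 1)` edges of `I`. -/
def Sparse (φ : β → α × α) (m : ℕ) (I : Finset β) : Prop :=
  ∀ A : Finset α, A.Nonempty → #(inside φ I A) + m ≤ m * #A

/-- `A` is tight for `I`: it is nonempty and spans exactly `m (|A| - 1)` edges of `I`. -/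
def Tight (φ : β → α × α) (m : ℕ) (I : Finset β) (A : Finset α) : Prop :=
  A.Nonempty ∧ #(inside φ I A) + m = m * #A

/-- Two vertices are joined by `I` if they lie in a common tight set. -/
def Joined (φ : β → α × α) (m : ℕ) (I : Finset β) (x y : α) : Prop :=
  ∃ A, Tight φ m I A ∧ x ∈ A ∧ y ∈ A


/-! ### Uncrossing of tight sets and exchange of edges -/

lemma mem_inside : e ∈ inside φ I A ↔ e ∈ I ∧ (φ e).1 ∈ A ∧ (φ e).2 ∈ A := by
  simp [inside]

lemma inside_subset : inside φ I A ⊆ I := filter_subset _ _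

lemma inside_mono (h : I ⊆ J) (h' : A ⊆ B) : inside φ I A ⊆ inside φ J B := by
  intro e he
  rw [mem_inside] at he ⊢
  exact ⟨h he.1, h' he.2.1, h' he.2.2⟩

/-- Supermodularity, the source of all uncrossing below: the only loss is in the edges between `A \
B` and `B \ A`. -/
lemma card_inside_add_le (I : Finset β) (A B : Finset α) :
    #(inside φ I A) + #(inside φ I B) ≤ #(inside φ I (A ∪ B)) + #(inside φ I (A ∩ B)) := by
  rw [← card_union_add_card_inter]
  refine add_le_add (card_le_card ?_) (card_le_card ?_)
  · exact union_subset (inside_mono subset_rfl subset_union_left)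
      (inside_mono subset_rfl subset_union_right)
  · intro e he
    simp only [mem_inter, mem_inside] at he ⊢
    tauto

lemma Sparse.mono (h : Sparse φ m J) (hI : I ⊆ J) : Sparse φ m I := fun A hA =>
  (Nat.add_le_add_right (card_le_card (inside_mono hI subset_rfl)) m).trans (h A hA)

lemma sparse_empty (φ : β → α × α) (m : ℕ) : Sparse φ m ∅ := fun A hA => by
  have := hA.card_pos
  simpa [inside] using Nat.le_mul_of_pos_right m this

lemma Sparse.fst_ne_snd (h : Sparse φ m I) (he : e ∈ I) : (φ e).1 ≠ (φ e).2 := by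
  intro heq
  have h1 := h {(φ e).1} (singleton_nonempty _)
  have h2 : 0 < #(inside φ I {(φ e).1}) := card_pos.2 ⟨e, by simp [mem_inside, he, ← heq]⟩
  rw [card_singleton] at h1
  lia

lemma Sparse.tight_singleton (h : Sparse φ m I) (x : α) : Tight φ m I {x} := by
  refine ⟨singleton_nonempty _, ?_⟩
  have h1 := h {x} (singleton_nonempty _)
  rw [card_singleton] at h1 ⊢
  lia

lemma Tight.mono (hA : Tight φ m I A) (hJ : Sparse φ m J) (h : I ⊆ J) : Tight φ m J A := by
  refine ⟨hA.1, le_antisymm (hJ A hA.1) ?_⟩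
  rw [← hA.2]
  exact Nat.add_le_add_right (card_le_card (inside_mono h subset_rfl)) m

/-- A tight set of a subset spans the same edges in the larger sparse set. -/
lemma Tight.inside_eq (hA : Tight φ m I A) (hJ : Sparse φ m J) (h : I ⊆ J) :
    inside φ I A = inside φ J A := by
  refine eq_of_subset_of_card_le (inside_mono h subset_rfl) ?_
  have := hA.2
  have := (hA.mono hJ h).2
  lia

/-- The two tight counts add up to the sparsity bounds for union and intersection, so
supermodularity forces equality in both. The intersection must be nonempty for its sparsity bound to
apply. -/
lemma Tight.union_inter (hI : Sparse φ m I) (hA : Tight φ m I A) (hB : Tight φ m I B)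
    (hAB : (A ∩ B).Nonempty) : Tight φ m I (A ∪ B) ∧ Tight φ m I (A ∩ B) := by
  have hU : (A ∪ B).Nonempty := hA.1.mono subset_union_left
  have h1 := hI _ hU
  have h2 := hI _ hAB
  have h3 := card_inside_add_le (φ := φ) I A B
  have h4 := card_union_add_card_inter A B
  have h5 : m * #(A ∪ B) + m * #(A ∩ B) = m * #A + m * #B := by
    rw [← Nat.mul_add, ← Nat.mul_add, h4]
  have h6 := hA.2
  have h7 := hB.2
  exact ⟨⟨hU, by lia⟩, ⟨hAB, by lia⟩⟩

lemma Tight.union (hI : Sparse φ m I) (hA : Tight φ m I A) (hB : Tight φ m I B)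
    (hx : x ∈ A) (hx' : x ∈ B) : Tight φ m I (A ∪ B) :=
  (hA.union_inter hI hB ⟨x, mem_inter.2 ⟨hx, hx'⟩⟩).1

lemma Sparse.joined_refl (hI : Sparse φ m I) (x : α) : Joined φ m I x x :=
  ⟨{x}, hI.tight_singleton x, by simp, by simp⟩

lemma Joined.symm (h : Joined φ m I x y) : Joined φ m I y x := by
  obtain ⟨A, hA, hx, hy⟩ := h
  exact ⟨A, hA, hy, hx⟩

lemma Joined.trans (hI : Sparse φ m I) (h : Joined φ m I x y) (h' : Joined φ m I y z) :
    Joined φ m I x z := by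
  obtain ⟨A, hA, hx, hy⟩ := h
  obtain ⟨B, hB, hy', hz⟩ := h'
  exact ⟨A ∪ B, hA.union hI hB hy hy', mem_union_left _ hx, mem_union_right _ hz⟩

lemma Joined.mono (h : Joined φ m I x y) (hJ : Sparse φ m J) (hIJ : I ⊆ J) :
    Joined φ m J x y := by
  obtain ⟨A, hA, hx, hy⟩ := h
  exact ⟨A, hA.mono hJ hIJ, hx, hy⟩

lemma inside_insert_of_mem (h1 : (φ e).1 ∈ A) (h2 : (φ e).2 ∈ A) :
    inside φ (insert e I) A = insert e (inside φ I A) := by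
  ext g
  simp only [mem_inside, mem_insert]
  constructor
  · tauto
  · rintro (rfl | h)
    · exact ⟨Or.inl rfl, h1, h2⟩
    · tauto

lemma inside_insert_of_not_mem (h : ¬ ((φ e).1 ∈ A ∧ (φ e).2 ∈ A)) :
    inside φ (insert e I) A = inside φ I A := by
  ext g
  simp only [mem_inside, mem_insert]
  constructor
  · rintro ⟨rfl | h', h3⟩
    · exact absurd h3 h
    · exact ⟨h', h3⟩
  · tauto

/-- If adding an edge to a sparse set destroys sparsity, the ends of the edge are joined. -/
lemma Sparse.joined_of_not_insert (hI : Sparse φ m I) (h : ¬ Sparse φ m (insert e I)) :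
    Joined φ m I (φ e).1 (φ e).2 := by
  unfold Sparse at h
  push Not at h
  obtain ⟨A, hA, hlt⟩ := h
  by_cases hm : (φ e).1 ∈ A ∧ (φ e).2 ∈ A
  · refine ⟨A, ⟨hA, ?_⟩, hm.1, hm.2⟩
    rw [inside_insert_of_mem hm.1 hm.2] at hlt
    have := card_insert_le e (inside φ I A)
    have := hI A hA
    lia
  · rw [inside_insert_of_not_mem hm] at hlt
    exact absurd (hI A hA) (by lia)

/-- The inclusion-minimal tight set containing two joined vertices. -/
lemma Joined.exists_least (hI : Sparse φ m I) (h : Joined φ m I x y) :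
    ∃ Z, Tight φ m I Z ∧ x ∈ Z ∧ y ∈ Z ∧ ∀ B, Tight φ m I B → x ∈ B → y ∈ B → Z ⊆ B := by
  classical
  have hex : ∃ n, ∃ A, #A = n ∧ Tight φ m I A ∧ x ∈ A ∧ y ∈ A := by
    obtain ⟨A, hA⟩ := h
    exact ⟨#A, A, rfl, hA⟩
  obtain ⟨Z, hcard, hZ, hx, hy⟩ := Nat.find_spec hex
  refine ⟨Z, hZ, hx, hy, fun B hB hxB hyB => ?_⟩
  have hne : (Z ∩ B).Nonempty := ⟨x, mem_inter.2 ⟨hx, hxB⟩⟩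
  have hmin := Nat.find_min' hex ⟨Z ∩ B, rfl, (hZ.union_inter hI hB hne).2,
    mem_inter.2 ⟨hx, hxB⟩, mem_inter.2 ⟨hy, hyB⟩⟩
  rw [← hcard] at hmin
  rw [← eq_of_subset_of_card_le inter_subset_left hmin]
  exact inter_subset_right

/-- Exchange of an edge with one inside the least tight set containing its ends. -/
lemma Sparse.swap (hI : Sparse φ m I) {Z : Finset α}
    (hZ : ∀ B, Tight φ m I B → (φ e).1 ∈ B → (φ e).2 ∈ B → Z ⊆ B) (hf : f ∈ inside φ I Z) :
    Sparse φ m (insert e (I.erase f)) := by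
  intro A hA
  by_cases hm : (φ e).1 ∈ A ∧ (φ e).2 ∈ A
  · rw [inside_insert_of_mem hm.1 hm.2]
    have h1 := card_insert_le e (inside φ (I.erase f) A)
    have h2 := hI A hA
    -- A non-tight `A` has room for `e`. A tight `A` holding both ends of `e` contains `Z`, hence
    -- loses `f`.
    by_cases ht : #(inside φ I A) + m = m * #A
    · have hfA : f ∈ inside φ I A := inside_mono subset_rfl (hZ A ⟨hA, ht⟩ hm.1 hm.2) hf
      have h3 : inside φ (I.erase f) A ⊆ (inside φ I A).erase f := by
        intro g
        simp only [mem_inside, mem_erase]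
        tauto
      have h4 := card_le_card h3
      rw [card_erase_of_mem hfA] at h4
      have : 0 < #(inside φ I A) := card_pos.2 ⟨f, hfA⟩
      lia
    · have h3 := card_le_card (inside_mono (φ := φ) (erase_subset f I) (subset_refl A))
      lia
  · rw [inside_insert_of_not_mem hm]
    exact (hI.mono (erase_subset f I)) A hA

/-! ### Replacing the edges inside a tight set -/

/-- The edge sets `I` and `J` agree on all edges that do not lie inside `C`. -/
def AgreeOutside (φ : β → α × α) (C : Finset α) (I J : Finset β) : Prop :=
  ∀ e, ¬ ((φ e).1 ∈ C ∧ (φ e).2 ∈ C) → (e ∈ I ↔ e ∈ J)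

lemma AgreeOutside.symm (h : AgreeOutside φ C I J) : AgreeOutside φ C J I :=
  fun e he => (h e he).symm

lemma AgreeOutside.card_inside (h : AgreeOutside φ C I J)
    (hc : #(inside φ I C) = #(inside φ J C)) (hA : C ⊆ A) :
    #(inside φ I A) = #(inside φ J A) := by
  have key : ∀ K : Finset β, #(inside φ K A) = #(inside φ K C) +
      #((inside φ K A).filter fun e => ¬ ((φ e).1 ∈ C ∧ (φ e).2 ∈ C)) := by
    intro K
    rw [← card_filter_add_card_filter_not (s := inside φ K A)
      (fun e => (φ e).1 ∈ C ∧ (φ e).2 ∈ C)]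
    congr 2
    ext e
    simp only [mem_filter, mem_inside]
    constructor
    · tauto
    · rintro ⟨h1, h2, h3⟩
      exact ⟨⟨h1, hA h2, hA h3⟩, h2, h3⟩
  rw [key I, key J, hc]
  congr 2
  ext e
  simp only [mem_filter, mem_inside]
  constructor
  · rintro ⟨h1, h2⟩
    exact ⟨⟨(h e h2).1 h1.1, h1.2⟩, h2⟩
  · rintro ⟨h1, h2⟩
    exact ⟨⟨(h e h2).2 h1.1, h1.2⟩, h2⟩

lemma AgreeOutside.inside_eq_of_disjoint (h : AgreeOutside φ C I J) (hA : Disjoint A C) :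
    inside φ I A = inside φ J A := by
  ext e
  simp only [mem_inside]
  constructor
  · rintro ⟨h1, h2, h3⟩
    exact ⟨(h e fun hc => disjoint_left.1 hA h2 hc.1).1 h1, h2, h3⟩
  · rintro ⟨h1, h2, h3⟩
    exact ⟨(h e fun hc => disjoint_left.1 hA h2 hc.1).2 h1, h2, h3⟩

/-- Replacing the edges inside a tight set by another sparse tight family preserves sparsity. -/
lemma Sparse.of_agreeOutside (hI : Sparse φ m I) (hJ : Sparse φ m J) (hC : Tight φ m I C)
    (hCK : Tight φ m K C) (hIK : AgreeOutside φ C I K) (hJK : inside φ K C = inside φ J C) :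
    Sparse φ m K := by
  intro A hA
  by_cases hAC : Disjoint A C
  · rw [← hIK.inside_eq_of_disjoint hAC]
    exact hI A hA
  · have hne : (A ∩ C).Nonempty := by
      rwa [← not_disjoint_iff_nonempty_inter]
    have hU : (A ∪ C).Nonempty := hA.mono subset_union_left
    -- Uncross `A` with `C` in `K`: the union is bounded through `I`, which has as many edges there,
    -- the intersection through `J`, and `C` itself is tight in `K`.
    have h1 := card_inside_add_le (φ := φ) K A C
    have h2 : #(inside φ K (A ∪ C)) = #(inside φ I (A ∪ C)) := by
      refine hIK.symm.card_inside ?_ subset_union_right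
      have := hC.2
      have := hCK.2
      lia
    have h3 := hI _ hU
    have h4 : #(inside φ K (A ∩ C)) ≤ #(inside φ J (A ∩ C)) := by
      refine card_le_card fun e he => ?_
      have he' : e ∈ inside φ J C := hJK ▸ inside_mono subset_rfl inter_subset_right he
      rw [mem_inside] at he he' ⊢
      exact ⟨he'.1, he.2⟩
    have h5 := hJ _ hne
    have h6 := card_union_add_card_inter A C
    have h7 : m * #(A ∪ C) + m * #(A ∩ C) = m * #A + m * #C := by
      rw [← Nat.mul_add, ← Nat.mul_add, h6]
    have h8 := hCK.2
    lia

/-- A witness disjoint from `C` is untouched; one meeting `C` is enlarged to its union with `C`,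
where the replacement does not alter the edge count. -/
lemma Joined.of_agreeOutside (hI : Sparse φ m I) (hC : Tight φ m I C) (hC' : Tight φ m J C)
    (hIJ : AgreeOutside φ C I J) (h : Joined φ m I x y) : Joined φ m J x y := by
  obtain ⟨A, hA, hx, hy⟩ := h
  by_cases hAC : Disjoint A C
  · refine ⟨A, ⟨hA.1, ?_⟩, hx, hy⟩
    rw [← hIJ.inside_eq_of_disjoint hAC]
    exact hA.2
  · have hne : (A ∩ C).Nonempty := by
      rwa [← not_disjoint_iff_nonempty_inter]
    have hU := (hA.union_inter hI hC hne).1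
    refine ⟨A ∪ C, ⟨hU.1, ?_⟩, mem_union_left _ hx, mem_union_left _ hy⟩
    rw [← hU.2]
    congr 1
    refine hIJ.symm.card_inside ?_ subset_union_right
    have := hC.2
    have := hC'.2
    lia

/-! ### Maximal tight sets and connectivity -/

/-- `I` lives on the vertex set `V`. -/
def On (φ : β → α × α) (V : Finset α) (I : Finset β) : Prop :=
  ∀ e ∈ I, (φ e).1 ∈ V ∧ (φ e).2 ∈ V

lemma On.inside_eq (h : On φ V I) : inside φ I V = I :=
  filter_true_of_mem h

lemma On.mono (h : On φ V J) (hI : I ⊆ J) : On φ V I := fun e he => h e (hI he)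

/-- Vertices outside `V` carry no edges, so discarding them would leave too many edges on the
remaining set. -/
lemma Tight.subset_of_on (hm : 0 < m) (hI : Sparse φ m I) (hV : On φ V I) (hA : Tight φ m I A)
    (hx : x ∈ A) (hxV : x ∈ V) : A ⊆ V := by
  have hne : (A ∩ V).Nonempty := ⟨x, mem_inter.2 ⟨hx, hxV⟩⟩
  have h1 := hI _ hne
  have h2 : inside φ I A = inside φ I (A ∩ V) := by
    ext e
    simp only [mem_inside, mem_inter]
    constructor
    · rintro ⟨h1, h2, h3⟩
      exact ⟨h1, ⟨h2, (hV e h1).1⟩, h3, (hV e h1).2⟩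
    · tauto
  have h3 := hA.2
  rw [h2] at h3
  have h4 : #A ≤ #(A ∩ V) := by
    refine Nat.le_of_mul_le_mul_left ?_ hm
    lia
  rw [← eq_of_subset_of_card_le inter_subset_left h4]
  exact inter_subset_right

/-- Every vertex lies in a tight set that contains all the vertices joined to it. -/
lemma Sparse.exists_component (hm : 0 < m) (hI : Sparse φ m I) (hV : On φ V I) (hx : x ∈ V) :
    ∃ C, Tight φ m I C ∧ x ∈ C ∧ C ⊆ V ∧ ∀ y, Joined φ m I x y → y ∈ C := by
  classical
  obtain ⟨C, hC, hmax⟩ := exists_max_image (V.powerset.filter fun A => Tight φ m I A ∧ x ∈ A)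
    card ⟨{x}, by simpa [hx] using hI.tight_singleton x⟩
  simp only [mem_filter, mem_powerset] at hC hmax
  refine ⟨C, hC.2.1, hC.2.2, hC.1, ?_⟩
  rintro y ⟨B, hB, hxB, hyB⟩
  have hU := hC.2.1.union hI hB hC.2.2 hxB
  have h1 := hmax (C ∪ B) ⟨hU.subset_of_on hm hI hV (mem_union_left _ hC.2.2) hx, hU,
    mem_union_left _ hC.2.2⟩
  rw [eq_of_subset_of_card_le subset_union_left h1]
  exact mem_union_right _ hyB

/-- Adding at most `m` edges from a new vertex to the rest preserves sparsity. -/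
lemma Sparse.union_star (hI : Sparse φ m I) (hloop : ∀ e ∈ K, (φ e).1 ≠ (φ e).2) {v : α}
    (hK : ∀ e ∈ K, (φ e).1 = v ∨ (φ e).2 = v) (hv : ∀ e ∈ I, (φ e).1 ≠ v ∧ (φ e).2 ≠ v)
    (hcard : #K ≤ m) : Sparse φ m (I ∪ K) := by
  intro A hA
  by_cases hvA : v ∈ A
  · have hsub : inside φ (I ∪ K) A ⊆ inside φ I (A.erase v) ∪ inside φ K A := by
      intro e
      simp only [mem_inside, mem_union, mem_erase]
      rintro ⟨h1 | h1, h2⟩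
      · exact Or.inl ⟨h1, ⟨(hv e h1).1, h2.1⟩, (hv e h1).2, h2.2⟩
      · exact Or.inr ⟨h1, h2⟩
    have h1 := (card_le_card hsub).trans (card_union_le _ _)
    have h2 := (card_le_card (inside_subset (φ := φ) (I := K) (A := A))).trans hcard
    have h3 := card_erase_add_one hvA
    rcases (A.erase v).eq_empty_or_nonempty with h0 | hne
    · have hA1 : A = {v} := by
        rw [← insert_erase hvA, h0]
        rfl
      have h4 : inside φ (I ∪ K) A = ∅ := by
        rw [eq_empty_iff_forall_notMem]
        intro e he
        rw [mem_inside, hA1, mem_singleton, mem_singleton, mem_union] at he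
        rcases he.1 with h5 | h5
        · exact (hv e h5).1 he.2.1
        · exact hloop e h5 (he.2.1.trans he.2.2.symm)
      rw [h4, hA1]
      simp
    · have h4 := hI _ hne
      rw [← h3, Nat.mul_add]
      lia
  · have hsub : inside φ (I ∪ K) A ⊆ inside φ I A := by
      intro e
      simp only [mem_inside, mem_union]
      rintro ⟨h1 | h1, h2⟩
      · exact ⟨h1, h2⟩
      · rcases hK e h1 with h3 | h3
        · exact absurd (h3 ▸ h2.1) hvA
        · exact absurd (h3 ▸ h2.2) hvA
    exact (Nat.add_le_add_right (card_le_card hsub) m).trans (hI A hA)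

/-- A tight set is connected: a vertex set meeting it that no edge leaves contains it. -/
lemma Tight.subset_of_closed (hm : 0 < m) (hI : Sparse φ m I) (hA : Tight φ m I A)
    (hx : x ∈ A) (hxW : x ∈ W) (hW : ∀ e ∈ inside φ I A, (φ e).1 ∈ W ↔ (φ e).2 ∈ W) :
    A ⊆ W := by
  by_contra hnot
  have hne : (A \ W).Nonempty := by
    rwa [sdiff_nonempty]
  have hne' : (A ∩ W).Nonempty := ⟨x, mem_inter.2 ⟨hx, hxW⟩⟩
  -- With no edge between the two nonempty parts, `A` would span at most `m * (|A| - 2)` edges.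
  have hsub : inside φ I A ⊆ inside φ I (A \ W) ∪ inside φ I (A ∩ W) := by
    intro e he
    have h1 := hW e he
    rw [mem_inside] at he
    simp only [mem_union, mem_inside, mem_sdiff, mem_inter]
    tauto
  have h1 := (card_le_card hsub).trans (card_union_le _ _)
  have h2 := hI _ hne
  have h3 := hI _ hne'
  have h4 := card_sdiff_add_card_inter A W
  have h5 : m * #(A \ W) + m * #(A ∩ W) = m * #A := by rw [← Nat.mul_add, h4]
  have h6 := hA.2
  lia

/-! ### The arboricity theorem by forest exchange -/

/-- A packing of pairwise disjoint `1`-sparse subsets (forests) of `T`. -/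
structure IsForestPacking (φ : β → α × α) (T : Finset β) (P : Fin m → Finset β) : Prop where
  sparse : ∀ i, Sparse φ 1 (P i)
  subset : ∀ i, P i ⊆ T
  disjoint : ∀ i j, i ≠ j → Disjoint (P i) (P j)

/-- `Q` arises from the packing `P` by moving an uncovered edge `f` into one of the forests in
exchange for an edge `g` of the fundamental cycle of `f`. -/
def Exchange (φ : β → α × α) (T : Finset β) (P Q : Fin m → Finset β) : Prop :=
  ∃ i f g Z, f ∈ T ∧ (∀ k, f ∉ P k) ∧ Tight φ 1 (P i) Z ∧ (φ f).1 ∈ Z ∧ (φ f).2 ∈ Z ∧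
    (∀ B, Tight φ 1 (P i) B → (φ f).1 ∈ B → (φ f).2 ∈ B → Z ⊆ B) ∧ g ∈ inside φ (P i) Z ∧
    Q = Function.update P i (insert f ((P i).erase g))

lemma IsForestPacking.exchange {P Q : Fin m → Finset β} (hP : IsForestPacking φ T P)
    (h : Exchange φ T P Q) : IsForestPacking φ T Q ∧ ∑ i, #(Q i) = ∑ i, #(P i) := by
  obtain ⟨i, f, g, Z, hfT, hf, hZ, -, -, hmin, hg, rfl⟩ := h
  have hgP := inside_subset hg
  refine ⟨⟨fun k => ?_, fun k => ?_, ?_⟩, ?_⟩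
  · rcases eq_or_ne k i with rfl | hk
    · rw [Function.update_self]
      exact (hP.sparse k).swap hmin hg
    · rw [Function.update_of_ne hk]
      exact hP.sparse k
  · rcases eq_or_ne k i with rfl | hk
    · rw [Function.update_self]
      exact insert_subset hfT ((erase_subset _ _).trans (hP.subset k))
    · rw [Function.update_of_ne hk]
      exact hP.subset k
  · have key : ∀ k, k ≠ i → Disjoint (insert f ((P i).erase g)) (P k) := by
      intro k hk
      rw [disjoint_insert_left]
      exact ⟨hf k, (hP.disjoint i k hk.symm).mono_left (erase_subset _ _)⟩
    intro k l hkl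
    rcases eq_or_ne k i with rfl | hk
    · rw [Function.update_self, Function.update_of_ne hkl.symm]
      exact key l hkl.symm
    · rw [Function.update_of_ne hk]
      rcases eq_or_ne l i with rfl | hl
      · rw [Function.update_self]
        exact (key k hk).symm
      · rw [Function.update_of_ne hl]
        exact hP.disjoint k l hkl
  · refine sum_congr rfl fun k _ => ?_
    rcases eq_or_ne k i with rfl | hk
    · rw [Function.update_self, card_insert_of_notMem (fun h => hf k (erase_subset _ _ h)),
        card_erase_add_one hgP]
    · rw [Function.update_of_ne hk]

/-- The edges left uncovered by some packing that can be reached from `P` by exchanges. -/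
noncomputable def exchangeable (φ : β → α × α) (T : Finset β) (P : Fin m → Finset β) :
    Finset β := by
  classical
  exact T.filter fun f => ∃ Q, Relation.ReflTransGen (Exchange φ T) P Q ∧ ∀ k, f ∉ Q k

lemma mem_exchangeable {P : Fin m → Finset β} : f ∈ exchangeable φ T P ↔
    f ∈ T ∧ ∃ Q, Relation.ReflTransGen (Exchange φ T) P Q ∧ ∀ k, f ∉ Q k := by
  classical
  simp [exchangeable]

lemma IsForestPacking.reachable {P Q : Fin m → Finset β} (hP : IsForestPacking φ T P)
    (h : Relation.ReflTransGen (Exchange φ T) P Q) :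
    IsForestPacking φ T Q ∧ ∑ i, #(Q i) = ∑ i, #(P i) := by
  induction h with
  | refl => exact ⟨hP, rfl⟩
  | tail _ h ih =>
    have := ih.1.exchange h
    exact ⟨this.1, this.2.trans ih.2⟩

/-- One more exchange trades `f` for any chosen edge of its fundamental cycle, which then is itself
uncovered. -/
lemma inside_subset_exchangeable {P Q : Fin m → Finset β} (hP : IsForestPacking φ T P)
    (hPQ : Relation.ReflTransGen (Exchange φ T) P Q) {i : Fin m} {Z : Finset α}
    (hfT : f ∈ T) (hf : ∀ k, f ∉ Q k) (hZ : Tight φ 1 (Q i) Z) (h1 : (φ f).1 ∈ Z)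
    (h2 : (φ f).2 ∈ Z)
    (hmin : ∀ B, Tight φ 1 (Q i) B → (φ f).1 ∈ B → (φ f).2 ∈ B → Z ⊆ B) :
    inside φ (Q i) Z ⊆ exchangeable φ T P := by
  intro g hg
  have hQ := (hP.reachable hPQ).1
  have hgQ := inside_subset hg
  refine mem_exchangeable.2 ⟨hQ.subset i hgQ, _,
    hPQ.tail ⟨i, f, g, Z, hfT, hf, hZ, h1, h2, hmin, hg, rfl⟩, fun k => ?_⟩
  rcases eq_or_ne k i with rfl | hk
  · rw [Function.update_self, mem_insert, mem_erase]
    rintro (rfl | h)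
    · exact hf k hgQ
    · exact h.1 rfl
  · rw [Function.update_of_ne hk]
    exact fun h => disjoint_left.1 (hQ.disjoint k i hk) h hgQ

lemma tight_inter_of_inside_subset {Z : Finset α} (hZ : Tight φ m I Z) (h : inside φ I Z ⊆ J) :
    Tight φ m (I ∩ J) Z := by
  refine ⟨hZ.1, ?_⟩
  rw [← hZ.2]
  congr 2
  ext e
  have := @h e
  simp only [mem_inside, mem_inter] at this ⊢
  tauto

/-- The whole fundamental cycle is exchangeable, so its vertex set is tight in the exchangeable part
of the forest both before and after the exchange. All changes lie inside that tight set. This lets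
facts about a reachable packing be read off in `P`. -/
lemma joined_exchange_iff {P Q R : Fin m → Finset β} (hP : IsForestPacking φ T P)
    (hPQ : Relation.ReflTransGen (Exchange φ T) P Q) (hQR : Exchange φ T Q R) (k : Fin m) :
    Joined φ 1 (Q k ∩ exchangeable φ T P) x y ↔ Joined φ 1 (R k ∩ exchangeable φ T P) x y := by
  have hQ := (hP.reachable hPQ).1
  have hR := (hP.reachable (hPQ.tail hQR)).1
  obtain ⟨i, f, g, Z, hfT, hf, hZ, h1, h2, hmin, hg, rfl⟩ := hQR
  rcases eq_or_ne k i with rfl | hk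
  · have hsub := inside_subset_exchangeable hP hPQ hfT hf hZ h1 h2 hmin
    have hZQ := tight_inter_of_inside_subset hZ hsub
    set E := exchangeable φ T P
    have hRk := hR.sparse k
    rw [Function.update_self] at hRk ⊢
    have hfE : f ∈ E := mem_exchangeable.2 ⟨hfT, Q, hPQ, hf⟩
    have hg' := hg
    rw [mem_inside] at hg'
    have hagree : AgreeOutside φ Z (Q k ∩ E) (insert f ((Q k).erase g) ∩ E) := by
      intro e he
      have hef : e ≠ f := by
        rintro rfl
        exact he ⟨h1, h2⟩
      have heg : e ≠ g := by
        rintro rfl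
        exact he hg'.2
      simp [hef, heg]
    have hcard : #(inside φ (insert f ((Q k).erase g) ∩ E) Z) = #(inside φ (Q k ∩ E) Z) := by
      have hg2 : g ∈ inside φ (Q k ∩ E) Z :=
        mem_inside.2 ⟨mem_inter.2 ⟨hg'.1, hsub hg⟩, hg'.2⟩
      have : inside φ (insert f ((Q k).erase g) ∩ E) Z
          = insert f ((inside φ (Q k ∩ E) Z).erase g) := by
        ext e
        simp only [mem_inside, mem_inter, mem_insert, mem_erase]
        constructor
        · tauto
        · rintro (rfl | h)
          · exact ⟨⟨Or.inl rfl, hfE⟩, h1, h2⟩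
          · tauto
      rw [this, card_insert_of_notMem, card_erase_add_one hg2]
      intro h
      exact hf k (mem_inter.1 (inside_subset (erase_subset _ _ h))).1
    have hZR : Tight φ 1 (insert f ((Q k).erase g) ∩ E) Z := ⟨hZQ.1, hcard ▸ hZQ.2⟩
    exact ⟨Joined.of_agreeOutside ((hQ.sparse k).mono inter_subset_left) hZQ hZR hagree,
      Joined.of_agreeOutside (hRk.mono inter_subset_left) hZR hZQ hagree.symm⟩
  · rw [Function.update_of_ne hk]

lemma joined_reachable_iff {P Q : Fin m → Finset β} (hP : IsForestPacking φ T P)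
    (hPQ : Relation.ReflTransGen (Exchange φ T) P Q) (k : Fin m) :
    Joined φ 1 (P k ∩ exchangeable φ T P) x y ↔ Joined φ 1 (Q k ∩ exchangeable φ T P) x y := by
  induction hPQ with
  | refl => rfl
  | tail h1 h2 ih => rw [ih, joined_exchange_iff hP h1 h2]

/-- In a maximum packing, the ends of each exchangeable edge are joined by the exchangeable edges
of each of the forests. -/
lemma IsForestPacking.joined {P : Fin m → Finset β} (hP : IsForestPacking φ T P)
    (hmax : ∀ Q : Fin m → Finset β, IsForestPacking φ T Q → ∑ i, #(Q i) ≤ ∑ i, #(P i))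
    (hf : f ∈ exchangeable φ T P) (k : Fin m) :
    Joined φ 1 (P k ∩ exchangeable φ T P) (φ f).1 (φ f).2 := by
  obtain ⟨hfT, Q, hPQ, hfQ⟩ := mem_exchangeable.1 hf
  rw [joined_reachable_iff hP hPQ]
  obtain ⟨hQ, hsum⟩ := hP.reachable hPQ
  have hns : ¬ Sparse φ 1 (insert f (Q k)) := by
    intro hs
    have hpack : IsForestPacking φ T (Function.update Q k (insert f (Q k))) := by
      have key : ∀ i, i ≠ k → Disjoint (insert f (Q k)) (Q i) := by
        intro i hi
        rw [disjoint_insert_left]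
        exact ⟨hfQ i, hQ.disjoint k i hi.symm⟩
      refine ⟨fun i => ?_, fun i => ?_, fun i j hij => ?_⟩
      · rcases eq_or_ne i k with rfl | hi
        · rwa [Function.update_self]
        · rw [Function.update_of_ne hi]
          exact hQ.sparse i
      · rcases eq_or_ne i k with rfl | hi
        · rw [Function.update_self]
          exact insert_subset hfT (hQ.subset i)
        · rw [Function.update_of_ne hi]
          exact hQ.subset i
      · rcases eq_or_ne i k with rfl | hi
        · rw [Function.update_self, Function.update_of_ne hij.symm]
          exact key j hij.symm
        · rw [Function.update_of_ne hi]
          rcases eq_or_ne j k with rfl | hj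
          · rw [Function.update_self]
            exact (key i hi).symm
          · rw [Function.update_of_ne hj]
            exact hQ.disjoint i j hij
    have h1 := hmax _ hpack
    have h2 : ∑ i, #(Q i) < ∑ i, #(Function.update Q k (insert f (Q k)) i) := by
      refine sum_lt_sum (fun i _ => ?_) ⟨k, mem_univ _, ?_⟩
      · rcases eq_or_ne i k with rfl | hi
        · rw [Function.update_self]
          exact card_le_card (subset_insert _ _)
        · rw [Function.update_of_ne hi]
      · rw [Function.update_self, card_insert_of_notMem (hfQ k)]
        exact Nat.lt_succ_self _
    lia
  obtain ⟨Z, hZ, h1, h2, hmin⟩ := ((hQ.sparse k).joined_of_not_insert hns).exists_least (hQ.sparse k)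
  exact ⟨Z, tight_inter_of_inside_subset hZ
    (inside_subset_exchangeable hP hPQ hfT hfQ hZ h1 h2 hmin), h1, h2⟩

lemma exists_on (φ : β → α × α) (T : Finset β) : ∃ V, On φ V T :=
  ⟨T.image (fun e => (φ e).1) ∪ T.image (fun e => (φ e).2), fun _ he =>
    ⟨mem_union_left _ (mem_image_of_mem (fun e => (φ e).1) he),
      mem_union_right _ (mem_image_of_mem (fun e => (φ e).2) he)⟩⟩

/-- The Nash-Williams arboricity theorem: an `m`-sparse edge set decomposes into `m` forests. -/
theorem Sparse.exists_forestPacking (hm : 0 < m) (hT : Sparse φ m T) :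
    ∃ P : Fin m → Finset β, IsForestPacking φ T P ∧ ∀ e ∈ T, ∃ i, e ∈ P i := by
  classical
  obtain ⟨P, hPmem, hmax⟩ := exists_max_image
    ((Fintype.piFinset fun _ : Fin m => T.powerset).filter (IsForestPacking φ T))
    (fun P => ∑ i, #(P i)) ⟨fun _ => ∅, by
      simp only [mem_filter, Fintype.mem_piFinset, mem_powerset, empty_subset, implies_true,
        true_and]
      exact ⟨fun _ => sparse_empty φ 1, fun _ => empty_subset _,
        fun _ _ _ => disjoint_empty_left _⟩⟩
  have hP : IsForestPacking φ T P := (mem_filter.1 hPmem).2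
  replace hmax : ∀ Q : Fin m → Finset β, IsForestPacking φ T Q → ∑ i, #(Q i) ≤ ∑ i, #(P i) :=
    fun Q hQ => hmax Q (by simpa [hQ] using hQ.subset)
  refine ⟨P, hP, ?_⟩
  by_contra! hcon
  obtain ⟨e, heT, heP⟩ := hcon
  obtain ⟨V, hV⟩ := exists_on φ T
  have heE : e ∈ exchangeable φ T P := mem_exchangeable.2 ⟨heT, P, .refl, heP⟩
  have hsp : ∀ i, Sparse φ 1 (P i ∩ exchangeable φ T P) :=
    fun i => (hP.sparse i).mono inter_subset_left
  have hcomp : ∀ i : Fin m, ∃ C, Tight φ 1 (P i ∩ exchangeable φ T P) C ∧ (φ e).1 ∈ C ∧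
      ∀ f ∈ exchangeable φ T P, (φ f).1 ∈ C ↔ (φ f).2 ∈ C := by
    intro i
    obtain ⟨C, hC, heC, -, hall⟩ := (hsp i).exists_component one_pos
      ((hV.mono (hP.subset i)).mono inter_subset_left) (hV e heT).1
    refine ⟨C, hC, heC, fun f hf => ⟨fun h => ?_, fun h => ?_⟩⟩
    · exact hall _ (Joined.trans (hsp i) ⟨C, hC, heC, h⟩ (hP.joined hmax hf i))
    · exact hall _ (Joined.trans (hsp i) ⟨C, hC, heC, h⟩ (hP.joined hmax hf i).symm)
  choose C hC heC hclosed using hcomp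
  -- `C i` is connected by exchangeable edges, and no exchangeable edge leaves `C j`; both contain
  -- an end of `e`, so all these sets coincide.
  have hsub : ∀ i j, C i ⊆ C j := fun i j =>
    (hC i).subset_of_closed one_pos (hsp i) (heC i) (heC j) fun f hf =>
      hclosed j f (mem_inter.1 (inside_subset hf)).2
  set i₀ : Fin m := ⟨0, hm⟩
  have hCeq : ∀ i, C i = C i₀ := fun i => (hsub i i₀).antisymm (hsub i₀ i)
  set U := C i₀
  -- The `m` forests each span a tree on `U`; the uncovered edge `e` is one edge more than sparsity
  -- allows.
  have hbig : insert e (univ.biUnion fun i => inside φ (P i) U) ⊆ inside φ T U := by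
    refine insert_subset (mem_inside.2 ⟨heT, heC i₀, (hclosed i₀ e heE).1 (heC i₀)⟩) ?_
    exact biUnion_subset.2 fun i _ => inside_mono (hP.subset i) subset_rfl
  have h1 := card_le_card hbig
  rw [card_insert_of_notMem, card_biUnion] at h1
  · have h2 : ∀ i : Fin m, #(inside φ (P i) U) + 1 = #U := by
      intro i
      have := ((hCeq i ▸ hC i).mono (hP.sparse i) inter_subset_left).2
      lia
    have h3 : ∑ i : Fin m, (#(inside φ (P i) U) + 1) = m * #U := by
      rw [sum_congr rfl fun i _ => h2 i]
      simp
    rw [sum_add_distrib] at h3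
    simp only [sum_const, card_univ, Fintype.card_fin, smul_eq_mul, mul_one] at h3
    have h4 := hT U ⟨_, heC i₀⟩
    lia
  · intro i _ j _ hij
    exact (hP.disjoint i j hij).mono inside_subset inside_subset
  · simp only [mem_biUnion, mem_univ, true_and, not_exists]
    exact fun i h => heP i (inside_subset h)

/-- In a decomposition into forests each forest spans the tight sets. -/
lemma IsForestPacking.tight {P : Fin m → Finset β} (hP : IsForestPacking φ T P)
    (hcov : ∀ e ∈ T, ∃ i, e ∈ P i) (hA : Tight φ m T A) (i : Fin m) : Tight φ 1 (P i) A := by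
  refine ⟨hA.1, ?_⟩
  by_contra hne
  have h1 : ∀ i, #(inside φ (P i) A) + 1 ≤ #A := fun i => by
    simpa using hP.sparse i A hA.1
  have h2 : inside φ T A ⊆ univ.biUnion fun i => inside φ (P i) A := by
    intro e he
    rw [mem_inside] at he
    obtain ⟨i, hi⟩ := hcov e he.1
    exact mem_biUnion.2 ⟨i, mem_univ _, mem_inside.2 ⟨hi, he.2⟩⟩
  have h3 := (card_le_card h2).trans card_biUnion_le
  -- Every forest has at most `|A| - 1` edges in `A`, so a single deficient forest makes the total
  -- too small for a tight set.
  have h4 : ∑ i : Fin m, (#(inside φ (P i) A) + 1) < ∑ _i : Fin m, #A :=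
    sum_lt_sum (fun i _ => h1 i) ⟨i, mem_univ _, by
      have := h1 i
      lia⟩
  rw [sum_add_distrib] at h4
  simp only [sum_const, card_univ, Fintype.card_fin, smul_eq_mul, mul_one] at h4
  have := hA.2
  lia

/-! ### The component partition and the rank formula -/

/-- The vertices of `V` joined to `x`. -/
noncomputable def component (φ : β → α × α) (m : ℕ) (I : Finset β) (V : Finset α) (x : α) :
    Finset α := by
  classical
  exact V.filter (Joined φ m I x)

lemma mem_component : y ∈ component φ m I V x ↔ y ∈ V ∧ Joined φ m I x y := by
  simp [component]

lemma Sparse.self_mem_component (hI : Sparse φ m I) (hx : x ∈ V) : x ∈ component φ m I V x :=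
  mem_component.2 ⟨hx, hI.joined_refl x⟩

lemma Sparse.tight_component (hm : 0 < m) (hI : Sparse φ m I) (hV : On φ V I) (hx : x ∈ V) :
    Tight φ m I (component φ m I V x) := by
  obtain ⟨C, hC, hxC, hCV, hall⟩ := hI.exists_component hm hV hx
  have : component φ m I V x = C := by
    ext y
    rw [mem_component]
    exact ⟨fun h => hall y h.2, fun h => ⟨hCV h, C, hC, hxC, h⟩⟩
  rwa [this]

lemma Sparse.component_eq_iff (hI : Sparse φ m I) (hy : y ∈ V) :
    component φ m I V x = component φ m I V y ↔ Joined φ m I x y := by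
  constructor
  · intro h
    have := hI.self_mem_component hy
    rw [← h] at this
    exact (mem_component.1 this).2
  · intro h
    ext z
    simp only [mem_component, and_congr_right_iff]
    exact fun _ => ⟨fun h' => h.symm.trans hI h', fun h' => h.trans hI h'⟩

/-- The partition of `V` into the maximal tight sets of `I`. -/
noncomputable def components (φ : β → α × α) (m : ℕ) (I : Finset β) (V : Finset α) :
    Finset (Finset α) :=
  V.image (component φ m I V)

/-- The edges of `K` whose ends are not joined by `I`. -/
noncomputable def crossing (φ : β → α × α) (m : ℕ) (I K : Finset β) : Finset β := by
  classical
  exact K.filter fun e => ¬ Joined φ m I (φ e).1 (φ e).2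

lemma mem_crossing : e ∈ crossing φ m I K ↔ e ∈ K ∧ ¬ Joined φ m I (φ e).1 (φ e).2 := by
  simp [crossing]

lemma Sparse.mem_iff_component_eq (hI : Sparse φ m I) (hA : A ∈ components φ m I V)
    (hx : x ∈ V) : x ∈ A ↔ component φ m I V x = A := by
  obtain ⟨y, hy, rfl⟩ := mem_image.1 hA
  rw [mem_component, hI.component_eq_iff hy]
  exact ⟨fun h => h.2.symm, fun h => ⟨hx, h.symm⟩⟩

lemma Sparse.pairwiseDisjoint_components (hI : Sparse φ m I) :
    (components φ m I V : Set (Finset α)).PairwiseDisjoint id := by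
  intro A hA B hB hAB
  refine disjoint_left.2 fun x hxA hxB => hAB ?_
  have hx : x ∈ V := by
    obtain ⟨y, -, rfl⟩ := mem_image.1 hA
    exact (mem_component.1 hxA).1
  rw [← (hI.mem_iff_component_eq hA hx).1 hxA, (hI.mem_iff_component_eq hB hx).1 hxB]

lemma Sparse.sum_card_components (hI : Sparse φ m I) : ∑ A ∈ components φ m I V, #A = #V := by
  refine (card_biUnion hI.pairwiseDisjoint_components).symm.trans ?_
  congr 1
  ext x
  simp only [mem_biUnion, components, mem_image, exists_exists_and_eq_and, id]
  exact ⟨fun ⟨y, _, hy⟩ => (mem_component.1 hy).1, fun h => ⟨x, h, hI.self_mem_component h⟩⟩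

/-- An edge set splits into the edges inside the components and the crossing edges. -/
lemma Sparse.card_eq_sum_inside_add (hI : Sparse φ m I) (hK : On φ V K) :
    #K = ∑ A ∈ components φ m I V, #(inside φ K A) + #(crossing φ m I K) := by
  classical
  rw [← card_filter_add_card_filter_not (s := K) fun e => Joined φ m I (φ e).1 (φ e).2]
  congr 1
  · rw [card_eq_sum_card_fiberwise (f := fun e => component φ m I V (φ e).1)
      (t := components φ m I V)]
    · refine sum_congr rfl fun A hA => ?_
      congr 1
      ext e
      rw [mem_filter, mem_filter, mem_inside]
      constructor
      · rintro ⟨⟨h1, h2⟩, h3⟩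
        refine ⟨h1, (hI.mem_iff_component_eq hA (hK e h1).1).2 h3,
          (hI.mem_iff_component_eq hA (hK e h1).2).2 ?_⟩
        rw [← h3, hI.component_eq_iff (hK e h1).1]
        exact h2.symm
      · rintro ⟨h1, h2, h3⟩
        rw [hI.mem_iff_component_eq hA (hK e h1).1] at h2
        rw [hI.mem_iff_component_eq hA (hK e h1).2] at h3
        exact ⟨⟨h1, (hI.component_eq_iff (hK e h1).2).1 (h2.trans h3.symm)⟩, h2⟩
    · intro e he
      exact mem_image_of_mem _ (hK e (mem_filter.1 he).1).1

lemma Sparse.tight_of_mem_components (hm : 0 < m) (hI : Sparse φ m I) (hV : On φ V I)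
    (hA : A ∈ components φ m I V) : Tight φ m I A := by
  obtain ⟨x, hx, rfl⟩ := mem_image.1 hA
  exact hI.tight_component hm hV hx

/-- Each component `A` is tight and contributes `m * (|A| - 1)` edges. This rank formula is what
turns `Ω_m` into the size of a sparse set. -/
lemma Sparse.card_add (hm : 0 < m) (hI : Sparse φ m I) (hV : On φ V I) :
    #I + m * #(components φ m I V) = m * #V + #(crossing φ m I I) := by
  have h1 := hI.card_eq_sum_inside_add hV
  have h2 : ∑ A ∈ components φ m I V, (#(inside φ I A) + m)
      = ∑ A ∈ components φ m I V, m * #A :=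
    sum_congr rfl fun A hA => (hI.tight_of_mem_components hm hV hA).2
  rw [sum_add_distrib, ← mul_sum, hI.sum_card_components, sum_const, smul_eq_mul, mul_comm] at h2
  lia

/-- A sparse set spanned by another one is not larger. -/
lemma Sparse.card_le_of_spanned (hm : 0 < m) (hD : Sparse φ m D) (hK : Sparse φ m K)
    (h : ∀ e ∈ K, e ∈ D ∨ Joined φ m D (φ e).1 (φ e).2) : #K ≤ #D := by
  obtain ⟨V, hV⟩ := exists_on φ (D ∪ K)
  have hVD := hV.mono subset_union_left
  have hVK := hV.mono subset_union_right
  have h1 := hD.card_eq_sum_inside_add hVK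
  have h2 := hD.card_add hm hVD
  have h3 : ∑ A ∈ components φ m D V, (#(inside φ K A) + m)
      ≤ ∑ A ∈ components φ m D V, m * #A :=
    sum_le_sum fun A hA => hK A (hD.tight_of_mem_components hm hVD hA).1
  rw [sum_add_distrib, ← mul_sum, hD.sum_card_components, sum_const, smul_eq_mul, mul_comm] at h3
  -- Inside the components `K` is bounded by sparsity, which `D` attains; an edge of `K` between
  -- components is not spanned, so it belongs to `D`.
  have h4 : #(crossing φ m D K) ≤ #(crossing φ m D D) := by
    refine card_le_card fun e he => ?_
    rw [mem_crossing] at he ⊢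
    exact ⟨(h e he.1).resolve_right he.2, he.2⟩
  lia

/-! ### Disjoint connected edge sets force tight sets -/

/-- `D` connects the vertex set `B`. -/
def Connects (φ : β → α × α) (D : Finset β) (B : Finset α) : Prop :=
  B.Nonempty ∧ ∀ (W : Finset α) (x : α), x ∈ B → x ∈ W →
    (∀ e ∈ inside φ D B, (φ e).1 ∈ W ↔ (φ e).2 ∈ W) → B ⊆ W

lemma Tight.connects (hm : 0 < m) (hI : Sparse φ m I) (hA : Tight φ m I A) :
    Connects φ I A :=
  ⟨hA.1, fun _ _ hx hxW hW => hA.subset_of_closed hm hI hx hxW hW⟩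

/-- A connected edge set has at least `k - 1` edges crossing a partition into `k` classes. -/
lemma Connects.card_image_le {γ : Type*} [DecidableEq γ] (h : Connects φ D B) (p : α → γ) :
    #(B.image p) ≤ #((inside φ D B).filter fun e => p (φ e).1 ≠ p (φ e).2) + 1 := by
  -- Grow a set `Q` of classes one at a time: connectivity supplies an edge leaving `Q`, and that
  -- edge becomes newly counted when its other class joins.
  have key : ∀ j, j + 1 ≤ #(B.image p) → ∃ Q ⊆ B.image p, #Q = j + 1 ∧
      j ≤ #((inside φ D B).filter fun e =>
        p (φ e).1 ≠ p (φ e).2 ∧ p (φ e).1 ∈ Q ∧ p (φ e).2 ∈ Q) := by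
    intro j
    induction j with
    | zero =>
      intro _
      obtain ⟨x, hx⟩ := h.1
      exact ⟨{p x}, by simpa using ⟨x, hx, rfl⟩, by simp, Nat.zero_le _⟩
    | succ j ih =>
      intro hj
      obtain ⟨Q, hQ, hcard, hle⟩ := ih (by lia)
      have hex : ∃ e ∈ inside φ D B, ¬ (p (φ e).1 ∈ Q ↔ p (φ e).2 ∈ Q) := by
        by_contra! hcon
        obtain ⟨q, hq⟩ := card_pos.1 (by lia : 0 < #Q)
        obtain ⟨x, hx, rfl⟩ := mem_image.1 (hQ hq)
        have h1 := h.2 (B.filter fun y => p y ∈ Q) x hx (mem_filter.2 ⟨hx, hq⟩) fun e he => by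
          have h2 := mem_inside.1 he
          simp only [mem_filter, h2.2, true_and]
          exact hcon e he
        have h3 : B.image p ⊆ Q := image_subset_iff.2 fun y hy => (mem_filter.1 (h1 hy)).2
        have := card_le_card h3
        lia
      obtain ⟨e, he, hne⟩ := hex
      have he' := mem_inside.1 he
      obtain ⟨q, hqB, hqQ, h1, h2⟩ : ∃ q ∈ B.image p, q ∉ Q ∧
          p (φ e).1 ∈ insert q Q ∧ p (φ e).2 ∈ insert q Q := by
        by_cases h1 : p (φ e).1 ∈ Q
        · exact ⟨p (φ e).2, mem_image_of_mem p he'.2.2, fun h2 => hne (by tauto),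
            mem_insert_of_mem h1, mem_insert_self _ _⟩
        · exact ⟨p (φ e).1, mem_image_of_mem p he'.2.1, h1, mem_insert_self _ _,
            mem_insert_of_mem (by tauto)⟩
      refine ⟨insert q Q, insert_subset hqB hQ, by rw [card_insert_of_notMem hqQ, hcard], ?_⟩
      refine Nat.succ_le_of_lt (hle.trans_lt (card_lt_card ?_))
      refine ssubset_iff_of_subset ?_ |>.2 ⟨e, ?_, ?_⟩
      · intro f
        simp only [mem_filter, mem_insert]
        tauto
      · refine mem_filter.2 ⟨he, fun heq => hne (by rw [heq]), h1, h2⟩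
      · simp only [mem_filter]
        tauto
  obtain ⟨x, hx⟩ := h.1
  have hpos : 0 < #(B.image p) := card_pos.2 ⟨p x, mem_image_of_mem p hx⟩
  obtain ⟨Q, -, -, hle⟩ := key (#(B.image p) - 1) (by lia)
  have hsub := card_le_card (show ((inside φ D B).filter fun e =>
      p (φ e).1 ≠ p (φ e).2 ∧ p (φ e).1 ∈ Q ∧ p (φ e).2 ∈ Q) ⊆
    (inside φ D B).filter fun e => p (φ e).1 ≠ p (φ e).2 from fun e he =>
      mem_filter.2 ⟨(mem_filter.1 he).1, (mem_filter.1 he).2.1⟩)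
  lia

/-- A vertex set spanned by `m` disjoint connected subsets of `E` lies in a tight set of each
maximal sparse subset of `E`. -/
lemma Sparse.exists_tight_superset (hm : 0 < m) (hI : Sparse φ m I) (hV : On φ V I)
    (hE : ∀ e ∈ E, e ∈ I ∨ Joined φ m I (φ e).1 (φ e).2) (hBV : B ⊆ V) {P : Fin m → Finset β}
    (hP : ∀ i, P i ⊆ E) (hdisj : ∀ i j, i ≠ j → Disjoint (P i) (P j))
    (hconn : ∀ i, Connects φ (P i) B) : ∃ A, Tight φ m I A ∧ B ⊆ A := by
  classical
  set p := component φ m I V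
  set Q := B.image p
  have hQ : Q ⊆ components φ m I V := image_subset_image hBV
  set U := Q.biUnion id
  have hBU : B ⊆ U := fun x hx => mem_biUnion.2
    ⟨p x, mem_image_of_mem p hx, hI.self_mem_component (hBV hx)⟩
  refine ⟨U, ⟨(hconn ⟨0, hm⟩).1.mono hBU, ?_⟩, hBU⟩
  refine le_antisymm (hI U ((hconn ⟨0, hm⟩).1.mono hBU)) ?_
  have hdis := hI.pairwiseDisjoint_components (V := V) |>.subset (coe_subset.2 hQ)
  have hU : #U = ∑ A ∈ Q, #A := card_biUnion hdis
  set c : Fin m → Finset β := fun i => (inside φ (P i) B).filter fun e => p (φ e).1 ≠ p (φ e).2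
  have hc : ∀ i, ∀ e ∈ c i, e ∈ P i ∧ e ∈ I ∧ (φ e).1 ∈ B ∧ (φ e).2 ∈ B ∧
      p (φ e).1 ≠ p (φ e).2 := by
    intro i e he
    obtain ⟨h1, h2⟩ := mem_filter.1 he
    rw [mem_inside] at h1
    refine ⟨h1.1, (hE e (hP i h1.1)).resolve_right fun hj => h2 ?_, h1.2.1, h1.2.2, h2⟩
    exact (hI.component_eq_iff (hBV h1.2.2)).2 hj
  -- The components meeting `B` give `m * (|U| - |Q|)` edges, and each of the `m` connected sets
  -- gives at least `|Q| - 1` crossing edges. Unspanned edges of `E` lie in `I`, so `U` is tight.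
  have hsub : (Q.biUnion fun A => inside φ I A) ∪ (univ.biUnion c) ⊆ inside φ I U := by
    refine union_subset (biUnion_subset.2 fun A hA =>
      inside_mono subset_rfl (subset_biUnion_of_mem id hA)) (biUnion_subset.2 fun i _ e he => ?_)
    obtain ⟨-, h2, h3, h4, -⟩ := hc i e he
    exact mem_inside.2 ⟨h2, hBU h3, hBU h4⟩
  have h1 := card_le_card hsub
  rw [card_union_of_disjoint, card_biUnion, card_biUnion] at h1
  · have h2 : ∑ A ∈ Q, (#(inside φ I A) + m) = ∑ A ∈ Q, m * #A :=
      sum_congr rfl fun A hA => (hI.tight_of_mem_components hm hV (hQ hA)).2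
    have h3 : ∑ _i : Fin m, #Q ≤ ∑ i : Fin m, (#(c i) + 1) :=
      sum_le_sum fun i _ => (hconn i).card_image_le p
    rw [sum_add_distrib, ← mul_sum, ← hU, sum_const, smul_eq_mul, mul_comm] at h2
    rw [sum_add_distrib] at h3
    simp only [sum_const, card_univ, Fintype.card_fin, smul_eq_mul, mul_one] at h3
    lia
  · exact fun i _ j _ hij => disjoint_left.2 fun e he he' =>
      disjoint_left.1 (hdisj i j hij) (hc i e he).1 (hc j e he').1
  · intro A hA B hB hAB
    refine disjoint_left.2 fun e he he' => ?_
    exact disjoint_left.1 (hdis hA hB hAB) (mem_inside.1 he).2.1 (mem_inside.1 he').2.1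
  · refine disjoint_left.2 fun e he he' => ?_
    obtain ⟨A, hA, heA⟩ := mem_biUnion.1 he
    obtain ⟨i, -, hei⟩ := mem_biUnion.1 he'
    obtain ⟨-, -, h3, h4, h5⟩ := hc i e hei
    rw [mem_inside, hI.mem_iff_component_eq (hQ hA) (hBV h3),
      hI.mem_iff_component_eq (hQ hA) (hBV h4)] at heA
    exact h5 (heA.2.1.trans heA.2.2.symm)

/-- Every sparse subset of `E` extends to a maximal one, and that one spans `E`. -/
lemma Sparse.exists_spanning (hF : Sparse φ m F) (hFE : F ⊆ E) :
    ∃ I, F ⊆ I ∧ I ⊆ E ∧ Sparse φ m I ∧ ∀ e ∈ E, e ∈ I ∨ Joined φ m I (φ e).1 (φ e).2 := by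
  classical
  obtain ⟨I, hI, hmax⟩ := exists_max_image
    (E.powerset.filter fun I => F ⊆ I ∧ Sparse φ m I) card ⟨F, by simp [hF, hFE]⟩
  simp only [mem_filter, mem_powerset] at hI hmax
  refine ⟨I, hI.2.1, hI.1, hI.2.2, fun e he => ?_⟩
  by_contra! hcon
  have hs : Sparse φ m (insert e I) := by
    by_contra hns
    exact hcon.2 (hI.2.2.joined_of_not_insert hns)
  have := hmax (insert e I) ⟨insert_subset he hI.1, hI.2.1.trans (subset_insert _ _), hs⟩
  rw [card_insert_of_notMem hcon.1] at this
  lia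

/-! ### Bases over `F` and their local modifications -/

/-- The edge `e` has an end in `S`. -/
def Touches (φ : β → α × α) (S : Finset α) (e : β) : Prop := (φ e).1 ∈ S ∨ (φ e).2 ∈ S

/-- The edges of `T` that belong to `F` or have no end in `S`. -/
noncomputable def keep (φ : β → α × α) (F : Finset β) (S : Finset α) (T : Finset β) :
    Finset β := by
  classical
  exact T.filter fun e => e ∈ F ∨ ¬ Touches φ S e

lemma mem_keep : e ∈ keep φ F S T ↔ e ∈ T ∧ (e ∈ F ∨ ¬ Touches φ S e) := by
  simp [keep]

lemma keep_subset : keep φ F S T ⊆ T := fun _ h => (mem_keep.1 h).1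

lemma keep_anti (h : S₀ ⊆ S₁) : keep φ F S₁ T ⊆ keep φ F S₀ T := by
  intro e he
  rw [mem_keep] at he ⊢
  exact ⟨he.1, he.2.imp_right fun h1 h2 => h1 (h2.imp (@h _) (@h _))⟩

/-- The number of edges of `I` incident with `v`. -/
def degree (φ : β → α × α) (I : Finset β) (v : α) : ℕ :=
  #(I.filter fun e => (φ e).1 = v ∨ (φ e).2 = v)

/-- `T` is an `m`-sparse subset of `E` that contains `F` and spans the vertex set `V`. -/
structure IsBaseOver (φ : β → α × α) (m : ℕ) (E F : Finset β) (V : Finset α) (T : Finset β) :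
    Prop where
  subset : T ⊆ E
  superset : F ⊆ T
  sparse : Sparse φ m T
  tight : Tight φ m T V

lemma IsBaseOver.card (hE : On φ V E) (hT : IsBaseOver φ m E F V T) : #T + m = m * #V := by
  rw [← hT.tight.2, (hE.mono hT.subset).inside_eq]

lemma IsBaseOver.of_card (hE : On φ V E) (hT : IsBaseOver φ m E F V T) (h1 : K ⊆ E) (h2 : F ⊆ K)
    (h3 : Sparse φ m K) (h4 : #K = #T) : IsBaseOver φ m E F V K :=
  ⟨h1, h2, h3, hT.tight.1, by rw [(hE.mono h1).inside_eq, h4, hT.card hE]⟩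

lemma AgreeOutside.mono (h : AgreeOutside φ A I J) (hAB : A ⊆ B) : AgreeOutside φ B I J :=
  fun e he => h e fun h' => he ⟨hAB h'.1, hAB h'.2⟩

lemma AgreeOutside.card_inside_eq (h : AgreeOutside φ C I J) (hc : #I = #J) :
    #(inside φ I C) = #(inside φ J C) := by
  have h1 := card_filter_add_card_filter_not (s := I) fun e => (φ e).1 ∈ C ∧ (φ e).2 ∈ C
  have h2 := card_filter_add_card_filter_not (s := J) fun e => (φ e).1 ∈ C ∧ (φ e).2 ∈ C
  have h3 : (I.filter fun e => ¬ ((φ e).1 ∈ C ∧ (φ e).2 ∈ C))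
      = J.filter fun e => ¬ ((φ e).1 ∈ C ∧ (φ e).2 ∈ C) := by
    ext e
    simp only [mem_filter]
    exact ⟨fun h' => ⟨(h e h'.2).1 h'.1, h'.2⟩, fun h' => ⟨(h e h'.2).2 h'.1, h'.2⟩⟩
  rw [h3] at h1
  unfold inside
  lia

lemma AgreeOutside.keep (h : AgreeOutside φ C T T') :
    AgreeOutside φ C (keep φ F S T) (keep φ F S T') := by
  intro e he
  rw [mem_keep, mem_keep, h e he]

/-- A modification inside a tight set that avoids `S` keeps that set tight. -/
lemma Tight.keep_of_agreeOutside (hT : Sparse φ m T) (hc : #T = #T')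
    (hC : Tight φ m (keep φ F S T) C) (h : AgreeOutside φ (C \ S) T T') :
    Tight φ m (keep φ F S T') C := by
  have h1 := hC.inside_eq hT keep_subset
  have h2 := (h.mono sdiff_subset).card_inside_eq hc
  have h3 : inside φ (keep φ F S T') C = inside φ T' C := by
    refine (inside_mono keep_subset subset_rfl).antisymm fun e he => ?_
    rw [mem_inside] at he
    -- An edge of `T'` touching `S` was not modified, so it lies in `T`. Since `C` is tight for the
    -- kept edges, all edges of `T` inside `C` are kept, and a kept edge touching `S` is in `F`.
    refine mem_inside.2 ⟨mem_keep.2 ⟨he.1, ?_⟩, he.2⟩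
    by_contra! hcon
    have heT : e ∈ T := by
      refine (h e fun hmem => ?_).2 he.1
      rw [mem_sdiff, mem_sdiff] at hmem
      rcases hcon.2 with h4 | h4
      · exact hmem.1.2 h4
      · exact hmem.2.2 h4
    have h4 : e ∈ inside φ (keep φ F S T) C := h1 ▸ mem_inside.2 ⟨heT, he.2⟩
    rcases (mem_keep.1 (inside_subset h4)).2 with h5 | h5
    · exact hcon.1 h5
    · exact h5 hcon.2
  refine ⟨hC.1, ?_⟩
  rw [h3, ← h2, ← h1, hC.2]

/-- `T'` is a base obtained from `T` by modifications that avoid `S` within a tight set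
containing `v`, such that the degree bounds `h` hold in `T'` on `X \ S`. -/
def IsLocalModification (φ : β → α × α) (m : ℕ) (E F : Finset β) (V X : Finset α) (h : α → ℤ)
    (S : Finset α) (v : α) (T T' : Finset β) : Prop :=
  IsBaseOver φ m E F V T' ∧ (∀ z ∈ X, z ∉ S → (degree φ T' z : ℤ) ≤ h z) ∧
    ∃ C, Tight φ m (keep φ F S T) C ∧ v ∈ C ∧ AgreeOutside φ (C \ S) T T'

lemma degree_congr (h : ∀ e, (φ e).1 = z ∨ (φ e).2 = z → (e ∈ I ↔ e ∈ J)) :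
    degree φ I z = degree φ J z := by
  unfold degree
  congr 1
  ext e
  simp only [mem_filter]
  exact ⟨fun h' => ⟨(h e h'.2).1 h'.1, h'.2⟩, fun h' => ⟨(h e h'.2).2 h'.1, h'.2⟩⟩

lemma AgreeOutside.degree_eq (h : AgreeOutside φ C I J) (hz : z ∉ C) :
    degree φ I z = degree φ J z :=
  degree_congr fun e he => h e fun h' => he.elim (fun h1 => hz (h1 ▸ h'.1))
    fun h1 => hz (h1 ▸ h'.2)

lemma degree_mono (h : I ⊆ J) (z : α) : degree φ I z ≤ degree φ J z :=
  card_le_card (filter_subset_filter _ h)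

lemma degree_insert_le (e : β) (I : Finset β) (z : α) :
    degree φ (insert e I) z ≤ degree φ I z + 1 := by
  unfold degree
  rw [filter_insert]
  split_ifs
  · exact card_insert_le _ _
  · lia

lemma degree_insert_of_ne (h1 : (φ e).1 ≠ z) (h2 : (φ e).2 ≠ z) :
    degree φ (insert e I) z = degree φ I z := by
  unfold degree
  rw [filter_insert, if_neg (by tauto)]

/-- Two local modifications in distinct components are carried out simultaneously. -/
lemma exists_combined_modification (hm : 0 < m) (hE : On φ V E) {h : α → ℤ}
    (hT : IsBaseOver φ m E F V T) {T₁ T₂ : Finset β} (hyV : y ∈ V)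
    (hnj : ¬ Joined φ m (keep φ F S T) x y)
    (h₁ : IsLocalModification φ m E F V X h S x T T₁)
    (h₂ : IsLocalModification φ m E F V X h S y T T₂) :
    ∃ Q C₁ C₂, IsBaseOver φ m E F V Q ∧ ¬ Joined φ m (keep φ F S Q) x y ∧
      Tight φ m (keep φ F S T) C₁ ∧ Tight φ m (keep φ F S T) C₂ ∧ x ∈ C₁ ∧ y ∈ C₂ ∧
      Disjoint C₁ C₂ ∧
      (∀ e, ¬ ((φ e).1 ∈ C₁ \ S ∧ (φ e).2 ∈ C₁ \ S) → ¬ ((φ e).1 ∈ C₂ \ S ∧ (φ e).2 ∈ C₂ \ S) →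
        (e ∈ Q ↔ e ∈ T)) ∧
      (∀ z ∈ X, z ∉ S → (degree φ Q z : ℤ) ≤ h z) ∧
      degree φ Q x = degree φ T₁ x ∧ degree φ Q y = degree φ T₂ y := by
  obtain ⟨hB₁, hd₁, C₁, hC₁, hx, ha₁⟩ := h₁
  obtain ⟨hB₂, hd₂, C₂, hC₂, hy, ha₂⟩ := h₂
  have hkT : Sparse φ m (keep φ F S T) := hT.sparse.mono keep_subset
  have hdisj : Disjoint C₁ C₂ := by
    refine disjoint_left.2 fun u hu hu' => hnj ?_
    exact ⟨C₁ ∪ C₂, hC₁.union hkT hC₂ hu hu', mem_union_left _ hx, mem_union_right _ hy⟩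
  have hcard₁ : #T = #T₁ := by
    have := hT.card hE
    have := hB₁.card hE
    lia
  have hcard₂ : #T = #T₂ := by
    have := hT.card hE
    have := hB₂.card hE
    lia
  have hC₂T := hC₂.mono hT.sparse keep_subset
  -- `Q` follows `T₂` inside `C₂` and `T₁` elsewhere. As `C₁` and `C₂` are disjoint, the definition
  -- is in effect symmetric.
  set Q := (T₁ \ inside φ T₁ C₂) ∪ inside φ T₂ C₂ with hQdef
  have hQin : ∀ e, (φ e).1 ∈ C₂ ∧ (φ e).2 ∈ C₂ → (e ∈ Q ↔ e ∈ T₂) := by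
    intro e he
    simp only [hQdef, mem_union, mem_sdiff, mem_inside]
    tauto
  have hQout : AgreeOutside φ C₂ T₁ Q := by
    intro e he
    simp only [hQdef, mem_union, mem_sdiff, mem_inside]
    tauto
  have hnot : ∀ e, (φ e).1 ∈ C₂ ∧ (φ e).2 ∈ C₂ → ¬ ((φ e).1 ∈ C₁ ∧ (φ e).2 ∈ C₁) :=
    fun e he he' => disjoint_left.1 hdisj he'.1 he.1
  have ha₁' := ha₁.mono (sdiff_subset (s := C₁) (t := S))
  have ha₂' := ha₂.mono (sdiff_subset (s := C₂) (t := S))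
  have hQout₁ : AgreeOutside φ C₁ T₂ Q := by
    intro e he
    by_cases h2 : (φ e).1 ∈ C₂ ∧ (φ e).2 ∈ C₂
    · exact (hQin e h2).symm
    · rw [← hQout e h2, ← ha₁' e he, ha₂' e h2]
  have hQT : ∀ e, ¬ ((φ e).1 ∈ C₁ \ S ∧ (φ e).2 ∈ C₁ \ S) →
      ¬ ((φ e).1 ∈ C₂ \ S ∧ (φ e).2 ∈ C₂ \ S) → (e ∈ Q ↔ e ∈ T) := by
    intro e h1 h2
    by_cases h3 : (φ e).1 ∈ C₂ ∧ (φ e).2 ∈ C₂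
    · rw [hQin e h3, ha₂ e h2]
    · rw [← hQout e h3, ha₁ e h1]
  have hagree : AgreeOutside φ (C₂ \ S) T₁ Q := by
    intro e h2
    by_cases h3 : (φ e).1 ∈ C₂ ∧ (φ e).2 ∈ C₂
    · rw [hQin e h3, ← ha₂ e h2, ← ha₁' e (hnot e h3)]
    · exact hQout e h3
  have hinQ : inside φ Q C₂ = inside φ T₂ C₂ := by
    ext e
    rw [mem_inside, mem_inside]
    exact ⟨fun h' => ⟨(hQin e h'.2).1 h'.1, h'.2⟩, fun h' => ⟨(hQin e h'.2).2 h'.1, h'.2⟩⟩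
  have hT₂C₂ : Tight φ m T₂ C₂ := ⟨hC₂.1, by rw [← ha₂'.card_inside_eq hcard₂, hC₂T.2]⟩
  have hQC₂ : Tight φ m Q C₂ := ⟨hC₂.1, by rw [hinQ, hT₂C₂.2]⟩
  have hin₁ : inside φ T C₂ = inside φ T₁ C₂ := ha₁'.inside_eq_of_disjoint hdisj.symm
  have hT₁C₂ : Tight φ m T₁ C₂ := ⟨hC₂.1, by rw [← hin₁, hC₂T.2]⟩
  have hQs : Sparse φ m Q := hB₁.sparse.of_agreeOutside hB₂.sparse hT₁C₂ hQC₂ hQout hinQ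
  have hQE : Q ⊆ E := union_subset (sdiff_subset.trans hB₁.subset)
    (inside_subset.trans hB₂.subset)
  have hFQ : F ⊆ Q := by
    intro e he
    by_cases h3 : (φ e).1 ∈ C₂ ∧ (φ e).2 ∈ C₂
    · exact (hQin e h3).2 (hB₂.superset he)
    · exact (hQout e h3).1 (hB₁.superset he)
  have hC₂V : C₂ ⊆ V := hC₂T.subset_of_on hm hT.sparse (hE.mono hT.subset) hy hyV
  have hQcard : #T₁ = #Q := by
    have h1 := hQout.card_inside (A := V) (by
      have := hT₁C₂.2
      have := hQC₂.2
      lia) hC₂V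
    rwa [(hE.mono hB₁.subset).inside_eq, (hE.mono hQE).inside_eq] at h1
  refine ⟨Q, C₁, C₂, hT.of_card hE hQE hFQ hQs (by lia), ?_, hC₁, hC₂, hx, hy, hdisj, hQT,
    ?_, ?_, ?_⟩
  · intro hj
    apply hnj
    have hk₁ : Sparse φ m (keep φ F S T₁) := hB₁.sparse.mono keep_subset
    have hkQ : Sparse φ m (keep φ F S Q) := hQs.mono keep_subset
    have hC₁' := hC₁.keep_of_agreeOutside hT.sparse hcard₁ ha₁
    have hC₂' : Tight φ m (keep φ F S T₁) C₂ := ⟨hC₂.1, by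
      rw [← (ha₁'.keep (F := F) (S := S)).inside_eq_of_disjoint hdisj.symm, hC₂.2]⟩
    have hC₂Q := hC₂'.keep_of_agreeOutside hB₁.sparse hQcard hagree
    -- A joining in `Q` is carried back first to `T₁`, across `C₂`, and then to `T`, across `C₁`.
    exact (hj.of_agreeOutside hkQ hC₂Q hC₂' hQout.keep.symm).of_agreeOutside hk₁ hC₁' hC₁
      ha₁'.keep.symm
  · intro z hz hzS
    by_cases hzC : z ∈ C₁
    · rw [← hQout.degree_eq (disjoint_left.1 hdisj hzC)]
      exact hd₁ z hz hzS
    · rw [← hQout₁.degree_eq hzC]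
      exact hd₂ z hz hzS
  · rw [← hQout.degree_eq (disjoint_left.1 hdisj hx)]
  · rw [← hQout₁.degree_eq (disjoint_right.1 hdisj hy)]

/-- If the ends of an unused edge `e` can be relieved locally, then adding `e` allows to remove
an edge with an end in `S₁ \ S₀`. -/
lemma exists_improvement (hm : 0 < m) (hE : On φ V E) {h : α → ℤ}
    (hT : IsBaseOver φ m E F V T) (hS : S₀ ⊆ S₁) {T₁ T₂ : Finset β} (he : e ∈ E) (heT : e ∉ T)
    (hx : (φ e).1 ∉ S₁) (hy : (φ e).2 ∉ S₁)
    (hj : Joined φ m (keep φ F S₀ T) (φ e).1 (φ e).2)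
    (hnj : ¬ Joined φ m (keep φ F S₁ T) (φ e).1 (φ e).2)
    (h₁ : IsLocalModification φ m E F V X h S₁ (φ e).1 T T₁)
    (h₁' : (φ e).1 ∈ X → (degree φ T₁ (φ e).1 : ℤ) < h (φ e).1)
    (h₂ : IsLocalModification φ m E F V X h S₁ (φ e).2 T T₂)
    (h₂' : (φ e).2 ∈ X → (degree φ T₂ (φ e).2 : ℤ) < h (φ e).2) :
    ∃ R w, w ∈ S₁ ∧ w ∉ S₀ ∧ IsBaseOver φ m E F V R ∧
      (∃ C, Tight φ m (keep φ F S₀ T) C ∧ w ∈ C ∧ AgreeOutside φ (C \ S₀) T R) ∧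
      degree φ R w < degree φ T w ∧ (∀ z ∈ S₁, degree φ R z ≤ degree φ T z) ∧
      ∀ z ∈ X, z ∉ S₁ → (degree φ R z : ℤ) ≤ h z := by
  obtain ⟨Q, C₁, C₂, hQ, hnjQ, hC₁, hC₂, hxC, hyC, hdisj, hQT, hdeg, hdx, hdy⟩ :=
    exists_combined_modification hm hE hT (hE e he).2 hnj h₁ h₂
  obtain ⟨C₀, hC₀, hx₀, hy₀⟩ := hj
  have hk₀ : Sparse φ m (keep φ F S₀ T) := hT.sparse.mono keep_subset
  -- This tight set contains both ends of `e` and both modified regions, so the whole improvement is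
  -- local with respect to `S₀`.
  have hC : Tight φ m (keep φ F S₀ T) (C₀ ∪ C₁ ∪ C₂) :=
    (hC₀.union hk₀ (hC₁.mono hk₀ (keep_anti hS)) hx₀ hxC).union hk₀
      (hC₂.mono hk₀ (keep_anti hS)) (mem_union_left _ hy₀) hyC
  set C := C₀ ∪ C₁ ∪ C₂
  have hsub₁ : C₁ ⊆ C := subset_union_right.trans subset_union_left
  have hsub₂ : C₂ ⊆ C := subset_union_right
  have hxC' := hsub₁ hxC
  have hyC' := hsub₂ hyC
  have hcard : #T = #Q := by
    have := hT.card hE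
    have := hQ.card hE
    lia
  have hagree : AgreeOutside φ (C \ S₀) T Q := by
    intro g hg
    refine (hQT g (fun h' => hg ?_) (fun h' => hg ?_)).symm
    · exact ⟨sdiff_subset_sdiff hsub₁ hS h'.1, sdiff_subset_sdiff hsub₁ hS h'.2⟩
    · exact ⟨sdiff_subset_sdiff hsub₂ hS h'.1, sdiff_subset_sdiff hsub₂ hS h'.2⟩
  have htouch : ∀ g, Touches φ S₁ g → (g ∈ Q ↔ g ∈ T) := by
    intro g hg
    refine hQT g (fun h' => ?_) (fun h' => ?_) <;>
    · rw [mem_sdiff, mem_sdiff] at h'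
      exact hg.elim h'.1.2 h'.2.2
  have hCQ := hC.keep_of_agreeOutside hT.sparse hcard hagree
  have hCQ' := hCQ.mono hQ.sparse keep_subset
  obtain ⟨Z, hZ, hxZ, hyZ, hmin⟩ :=
    Joined.exists_least hQ.sparse ⟨C, hCQ', hxC', hyC'⟩
  have hZC : Z ⊆ C := hmin C hCQ' hxC' hyC'
  -- If every edge of the least tight set around `e` were kept for `S₁`, the ends of `e` would be
  -- joined in `keep φ F S₁ Q`.
  obtain ⟨f, hfZ, hfk⟩ : ∃ f ∈ inside φ Q Z, f ∉ keep φ F S₁ Q := by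
    by_contra! hcon
    refine hnjQ ⟨Z, ⟨hZ.1, ?_⟩, hxZ, hyZ⟩
    rw [← hZ.2]
    congr 2
    refine (inside_mono keep_subset subset_rfl).antisymm fun g hg => ?_
    exact mem_inside.2 ⟨hcon g hg, (mem_inside.1 hg).2⟩
  have hfQ := inside_subset hfZ
  have hfZ' := (mem_inside.1 hfZ).2
  rw [mem_keep] at hfk
  have hfF : f ∉ F := fun h' => hfk ⟨hfQ, Or.inl h'⟩
  have hfS₁ : Touches φ S₁ f := by
    by_contra h'
    exact hfk ⟨hfQ, Or.inr h'⟩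
  -- `C` is tight for the edges kept for `S₀`, so `f` is kept for `S₀` although it is outside `F`.
  have hfS₀ : ¬ Touches φ S₀ f := by
    have h1 : f ∈ inside φ (keep φ F S₀ Q) C :=
      (hCQ.inside_eq hQ.sparse keep_subset) ▸ inside_mono subset_rfl hZC hfZ
    exact (mem_keep.1 (inside_subset h1)).2.resolve_left hfF
  obtain ⟨w, hw, hwS₁⟩ : ∃ w, ((φ f).1 = w ∨ (φ f).2 = w) ∧ w ∈ S₁ :=
    hfS₁.elim (fun h' => ⟨_, Or.inl rfl, h'⟩) (fun h' => ⟨_, Or.inr rfl, h'⟩)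
  have hwS₀ : w ∉ S₀ := fun h' => hfS₀ (by
    rcases hw with h1 | h1
    · exact Or.inl (h1 ▸ h')
    · exact Or.inr (h1 ▸ h'))
  have hwC : w ∈ C := hw.elim (fun h1 => h1 ▸ hZC hfZ'.1) (fun h1 => h1 ▸ hZC hfZ'.2)
  have heQ : e ∉ Q := by
    rw [hQT e]
    · exact heT
    · exact fun h' => disjoint_left.1 hdisj (mem_sdiff.1 h'.2).1 hyC
    · exact fun h' => disjoint_left.1 hdisj hxC (mem_sdiff.1 h'.1).1
  -- At the vertices of `S₁` the modifications changed nothing and `e` is absent, so edges can only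
  -- be lost there.
  have hRat : ∀ z ∈ S₁, ((insert e (Q.erase f)).filter fun g => (φ g).1 = z ∨ (φ g).2 = z) ⊆
      (T.erase f).filter fun g => (φ g).1 = z ∨ (φ g).2 = z := by
    intro z hz g hg
    simp only [mem_filter, mem_insert, mem_erase] at hg ⊢
    refine ⟨?_, hg.2⟩
    have hgS : Touches φ S₁ g := by
      rcases hg.2 with h1 | h1
      · exact Or.inl (h1 ▸ hz)
      · exact Or.inr (h1 ▸ hz)
    rcases hg.1 with rfl | h1
    · exact absurd hgS (not_or.2 ⟨hx, hy⟩)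
    · exact ⟨h1.1, (htouch g hgS).1 h1.2⟩
  refine ⟨insert e (Q.erase f), w, hwS₁, hwS₀, hT.of_card hE ?_ ?_ (hQ.sparse.swap hmin hfZ) ?_,
    ⟨C, hC, hwC, ?_⟩, ?_, ?_, ?_⟩
  · exact insert_subset he ((erase_subset _ _).trans hQ.subset)
  · intro g hg
    exact mem_insert_of_mem (mem_erase.2 ⟨fun h' => hfF (h' ▸ hg), hQ.superset hg⟩)
  · rw [card_insert_of_notMem fun h' => heQ (erase_subset _ _ h'), card_erase_add_one hfQ, hcard]
  · intro g hg
    have hge : g ≠ e := by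
      rintro rfl
      exact hg ⟨mem_sdiff.2 ⟨hxC', fun h' => hx (hS h')⟩,
        mem_sdiff.2 ⟨hyC', fun h' => hy (hS h')⟩⟩
    have hgf : g ≠ f := by
      rintro rfl
      exact hg ⟨mem_sdiff.2 ⟨hZC hfZ'.1, fun h' => hfS₀ (Or.inl h')⟩,
        mem_sdiff.2 ⟨hZC hfZ'.2, fun h' => hfS₀ (Or.inr h')⟩⟩
    simp only [mem_insert, mem_erase, hge, hgf, false_or, ne_eq, not_false_eq_true, true_and]
    exact hagree g hg
  · refine (card_le_card (hRat w hwS₁)).trans_lt (card_lt_card ?_)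
    refine (ssubset_iff_of_subset (filter_subset_filter _ (erase_subset _ _))).2
      ⟨f, mem_filter.2 ⟨(htouch f hfS₁).1 hfQ, hw⟩, by simp⟩
  · exact fun z hz => card_le_card ((hRat z hz).trans
      (filter_subset_filter _ (erase_subset _ _)))
  · intro z hz hzS
    have h3 := degree_mono (φ := φ) (erase_subset f Q) z
    have h4 := degree_insert_le (φ := φ) e (Q.erase f) z
    -- Adding `e` costs one degree at each end, paid for by the strict bounds obtained there.
    by_cases hzx : (φ e).1 = z
    · subst hzx
      have := h₁' hz
      lia
    · by_cases hzy : (φ e).2 = z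
      · subst hzy
        have := h₂' hz
        lia
      · rw [degree_insert_of_ne hzx hzy]
        have := hdeg z hz hzS
        lia

/-! ### Construction of a barrier -/

/-- The increasing sequence of barrier sets: it starts with the vertices whose degree is too
large, and a vertex is added when no local modification makes its degree less than the bound. -/
noncomputable def barrier (φ : β → α × α) (m : ℕ) (E F : Finset β) (V X : Finset α) (h : α → ℤ)
    (T : Finset β) : ℕ → Finset α
  | 0 => X.filter fun v => h v < degree φ T v
  | n + 1 => by
    classical
    exact barrier φ m E F V X h T n ∪ X.filter fun v => ∀ T',
      IsLocalModification φ m E F V X h (barrier φ m E F V X h T n) v T T' → h v ≤ degree φ T' v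

lemma barrier_subset {h : α → ℤ} (n : ℕ) : barrier φ m E F V X h T n ⊆ X := by
  induction n with
  | zero => exact filter_subset _ _
  | succ n ih =>
    classical
    rw [barrier]
    exact union_subset ih (filter_subset _ _)

lemma barrier_mono (φ : β → α × α) (m : ℕ) (E F : Finset β) (V X : Finset α) (h : α → ℤ)
    (T : Finset β) : Monotone (barrier φ m E F V X h T) :=
  monotone_nat_of_le_succ fun _ => subset_union_left

lemma mem_barrier_zero {h : α → ℤ} :
    v ∈ barrier φ m E F V X h T 0 ↔ v ∈ X ∧ h v < degree φ T v := by
  simp [barrier]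

lemma mem_barrier_succ {h : α → ℤ} {n : ℕ} : v ∈ barrier φ m E F V X h T (n + 1) ↔
    v ∈ barrier φ m E F V X h T n ∨ v ∈ X ∧ ∀ T',
      IsLocalModification φ m E F V X h (barrier φ m E F V X h T n) v T T' →
        h v ≤ degree φ T' v := by
  classical
  rw [barrier, mem_union, mem_filter]

lemma degree_le_of_not_mem_barrier {h : α → ℤ} {n : ℕ} (hv : v ∈ X)
    (hn : v ∉ barrier φ m E F V X h T n) : (degree φ T v : ℤ) ≤ h v := by
  by_contra! hcon
  exact hn (barrier_mono φ m E F V X h T (Nat.zero_le n) (mem_barrier_zero.2 ⟨hv, hcon⟩))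

lemma isLocalModification_self {h : α → ℤ} (hT : IsBaseOver φ m E F V T) (n : ℕ) (v : α) :
    IsLocalModification φ m E F V X h (barrier φ m E F V X h T n) v T T :=
  ⟨hT, fun _ hz hzS => degree_le_of_not_mem_barrier hz hzS, {v},
    (hT.sparse.mono keep_subset).tight_singleton v, mem_singleton_self v, fun _ _ => Iff.rfl⟩

/-- `T` is a local modification of itself, so it is among the bases tested when a vertex is added.
-/
lemma le_degree_of_mem_barrier {h : α → ℤ} (hT : IsBaseOver φ m E F V T) {n : ℕ}
    (hv : v ∈ barrier φ m E F V X h T n) : h v ≤ degree φ T v := by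
  induction n with
  | zero => exact (mem_barrier_zero.1 hv).2.le
  | succ n ih =>
    rcases mem_barrier_succ.1 hv with h1 | h1
    · exact ih h1
    · exact h1.2 T (isLocalModification_self hT n v)

lemma exists_isLocalModification_of_not_mem {h : α → ℤ} (hT : IsBaseOver φ m E F V T) {n : ℕ}
    (hv : v ∉ barrier φ m E F V X h T (n + 1)) : ∃ T',
      IsLocalModification φ m E F V X h (barrier φ m E F V X h T n) v T T' ∧
        (v ∈ X → (degree φ T' v : ℤ) < h v) := by
  by_cases hvX : v ∈ X
  · rw [mem_barrier_succ, not_or] at hv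
    have h1 := hv.2
    push Not at h1
    obtain ⟨T', h2, h3⟩ := h1 hvX
    exact ⟨T', h2, fun _ => h3⟩
  · exact ⟨T, isLocalModification_self hT n v, fun h' => absurd h' hvX⟩

/-- The total amount by which the degrees of `T` exceed the bounds `h` on `X`. -/
def totalExcess (φ : β → α × α) (X : Finset α) (h : α → ℤ) (T : Finset β) : ℕ :=
  ∑ v ∈ X, (degree φ T v - h v).toNat

/-- For a base of minimum total excess, an edge avoiding a vertex set `barrier (n + 1)` is spanned
by the edges kept for `barrier n`. -/
lemma joined_keep_barrier (hm : 0 < m) (hE : On φ V E) {h : α → ℤ}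
    (hT : IsBaseOver φ m E F V T)
    (hmin : ∀ T', IsBaseOver φ m E F V T' → totalExcess φ X h T ≤ totalExcess φ X h T')
    (he : e ∈ E) (heT : e ∉ T) (n : ℕ) (hx : (φ e).1 ∉ barrier φ m E F V X h T (n + 1))
    (hy : (φ e).2 ∉ barrier φ m E F V X h T (n + 1)) :
    Joined φ m (keep φ F (barrier φ m E F V X h T n) T) (φ e).1 (φ e).2 := by
  induction n with
  | zero =>
    by_contra hnj
    obtain ⟨T₁, h₁, h₁'⟩ := exists_isLocalModification_of_not_mem hT hx
    obtain ⟨T₂, h₂, h₂'⟩ := exists_isLocalModification_of_not_mem hT hy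
    -- The level below the first barrier set is `∅`: there all of `T` is kept and `V` is tight.
    have hj : Joined φ m (keep φ F ∅ T) (φ e).1 (φ e).2 := by
      refine Joined.mono ⟨V, hT.tight, hE e he⟩ (hT.sparse.mono keep_subset) fun g hg => ?_
      exact mem_keep.2 ⟨hg, Or.inr (by simp [Touches])⟩
    obtain ⟨R, w, hw, -, hR, -, hlt, hle, hb⟩ := exists_improvement hm hE hT
      (empty_subset _) he heT (fun h' => hx (subset_union_left h'))
      (fun h' => hy (subset_union_left h')) hj hnj h₁ h₁' h₂ h₂'
    refine absurd (hmin R hR) (not_le.2 (sum_lt_sum (fun z hz => ?_) ⟨w, ?_, ?_⟩))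
    · by_cases hz0 : z ∈ barrier φ m E F V X h T 0
      · have := hle z hz0
        lia
      · have := hb z hz hz0
        lia
    · exact barrier_subset _ hw
    · have := (mem_barrier_zero.1 hw).2
      lia
  | succ n ih =>
    by_contra hnj
    have hsub : barrier φ m E F V X h T (n + 1) ⊆ barrier φ m E F V X h T (n + 1 + 1) :=
      barrier_mono φ m E F V X h T (Nat.le_succ _)
    obtain ⟨T₁, h₁, h₁'⟩ := exists_isLocalModification_of_not_mem hT hx
    obtain ⟨T₂, h₂, h₂'⟩ := exists_isLocalModification_of_not_mem hT hy
    obtain ⟨R, w, hw, hw', hR, hC, hlt, hle, hb⟩ := exists_improvement hm hE hT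
      (barrier_mono φ m E F V X h T (Nat.le_succ n)) he heT (fun h' => hx (hsub h'))
      (fun h' => hy (hsub h')) (ih (fun h' => hx (hsub h')) fun h' => hy (hsub h')) hnj
      h₁ h₁' h₂ h₂'
    -- `w` entered exactly at level `n + 1`, so no local modification at level `n` brings its degree
    -- below `h w`. `R` is such a modification and does.
    obtain ⟨hwX, hwall⟩ := (mem_barrier_succ.1 hw).resolve_left hw'
    have h3 := hwall R ⟨hR, fun z hz hzS => ?_, hC⟩
    · have := degree_le_of_not_mem_barrier hwX hw'
      lia
    · by_cases hz1 : z ∈ barrier φ m E F V X h T (n + 1)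
      · have := hle z hz1
        have := degree_le_of_not_mem_barrier hz hzS
        lia
      · exact hb z hz hz1

/-- If no base over `F` satisfies the degree bounds, then some base `T` has a barrier `S`: the
degrees of `T` on `S` are at least the bounds, one of them is larger, and all edges avoiding `S`
are spanned by `F` and the edges of `T` avoiding `S`. -/
theorem exists_barrier (hm : 0 < m) (hE : On φ V E) (h : α → ℤ)
    (hT : IsBaseOver φ m E F V T)
    (hno : ∀ T', IsBaseOver φ m E F V T' → ∃ v ∈ X, h v < degree φ T' v) :
    ∃ T S, IsBaseOver φ m E F V T ∧ S ⊆ X ∧ (∀ v ∈ S, h v ≤ degree φ T v) ∧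
      (∃ v ∈ S, h v < degree φ T v) ∧
      ∀ e ∈ E, ¬ Touches φ S e →
        e ∈ keep φ F S T ∨ Joined φ m (keep φ F S T) (φ e).1 (φ e).2 := by
  classical
  obtain ⟨T, hTmem, hmin⟩ := exists_min_image (E.powerset.filter (IsBaseOver φ m E F V))
    (totalExcess φ X h) ⟨T, by simpa [hT] using hT.subset⟩
  replace hT : IsBaseOver φ m E F V T := (mem_filter.1 hTmem).2
  replace hmin : ∀ T', IsBaseOver φ m E F V T' → totalExcess φ X h T ≤ totalExcess φ X h T' :=
    fun T' hT' => hmin T' (by simpa [hT'] using hT'.subset)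
  -- A strictly increasing sequence of subsets of `X` would outgrow `X`.
  obtain ⟨N, hN⟩ : ∃ N, barrier φ m E F V X h T (N + 1) = barrier φ m E F V X h T N := by
    by_contra! hcon
    have hlt : ∀ n, n ≤ #(barrier φ m E F V X h T n) := by
      intro n
      induction n with
      | zero => exact Nat.zero_le _
      | succ n ih =>
        refine Nat.succ_le_of_lt (ih.trans_lt (card_lt_card ?_))
        exact (barrier_mono φ m E F V X h T (Nat.le_succ n)).lt_of_ne (hcon n).symm
    have h1 := hlt (#X + 1)
    have h2 := card_le_card (barrier_subset (φ := φ) (m := m) (E := E) (F := F) (V := V)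
      (X := X) (h := h) (T := T) (#X + 1))
    lia
  refine ⟨T, barrier φ m E F V X h T N, hT, barrier_subset N,
    fun v hv => le_degree_of_mem_barrier hT hv, ?_, fun e he hS => ?_⟩
  · obtain ⟨v, hv, hlt⟩ := hno T hT
    exact ⟨v, barrier_mono φ m E F V X h T (Nat.zero_le N) (mem_barrier_zero.2 ⟨hv, hlt⟩), hlt⟩
  · by_cases heT : e ∈ T
    · exact Or.inl (mem_keep.2 ⟨heT, Or.inr hS⟩)
    · rw [Touches, not_or, ← hN] at hS
      exact Or.inr (joined_keep_barrier hm hE hT hmin he heT N hS.1 hS.2)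

/-! ### Counting edges at a barrier -/

/-- The edges of `I` with an end in `S`. -/
noncomputable def touching (φ : β → α × α) (I : Finset β) (S : Finset α) : Finset β := by
  classical
  exact I.filter (Touches φ S)

lemma mem_touching : e ∈ touching φ I S ↔ e ∈ I ∧ Touches φ S e := by
  simp [touching]

lemma sum_degree (hI : ∀ e ∈ I, (φ e).1 ≠ (φ e).2) (S : Finset α) :
    ∑ v ∈ S, degree φ I v = #(touching φ I S) + #(inside φ I S) := by
  classical
  unfold degree touching inside
  simp only [card_filter]
  rw [sum_comm, ← sum_add_distrib]
  refine sum_congr rfl fun e he => ?_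
  have h1 : ∀ v, (if (φ e).1 = v ∨ (φ e).2 = v then 1 else 0)
      = (if (φ e).1 = v then 1 else 0) + (if (φ e).2 = v then 1 else 0) := by
    intro v
    by_cases h2 : (φ e).1 = v
    · have h3 : (φ e).2 ≠ v := fun h3 => hI e he (h2.trans h3.symm)
      simp [h2, h3]
    · simp [h2]
  simp only [h1, sum_add_distrib, sum_ite_eq, Touches]
  by_cases h2 : (φ e).1 ∈ S <;> by_cases h3 : (φ e).2 ∈ S <;> simp [h2, h3]

/-- A sparse set avoiding `S` can be extended by edges of `F`, gaining at least
`min m (d_F v)` for each vertex `v` of `S` up to the number of edges of `F` inside `S`. -/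
lemma Sparse.exists_extension (hI : Sparse φ m I) (hIS : ∀ e ∈ I, ¬ Touches φ S e)
    (hF : ∀ e ∈ F, (φ e).1 ≠ (φ e).2) :
    ∃ K, Sparse φ m K ∧ K ⊆ I ∪ F ∧
      #I + ∑ v ∈ S, min m (degree φ F v) ≤ #K + #(inside φ F S) := by
  classical
  -- Process the vertices of `S` one by one. `K` avoids the unprocessed ones, so the next vertex `v`
  -- is new to it and can receive up to `m` edges of `F`.
  have key : ∀ S', S' ⊆ S → ∃ K, Sparse φ m K ∧ K ⊆ I ∪ F ∧ (∀ e ∈ K, ¬ Touches φ (S \ S') e) ∧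
      #I + ∑ v ∈ S', min m (degree φ F v) ≤ #K + #((inside φ F S).filter (Touches φ S')) := by
    intro S'
    induction S' using Finset.induction_on with
    | empty =>
      intro _
      exact ⟨I, hI, subset_union_left, by simpa using hIS, by simp⟩
    | insert v S' hv ih =>
      intro hS'
      obtain ⟨K, hK, hKsub, hKS, hle⟩ := ih ((subset_insert _ _).trans hS')
      have hvS : v ∈ S := hS' (mem_insert_self _ _)
      set a := F.filter fun e => (φ e).1 = v ∨ (φ e).2 = v with ha
      set N := a.filter fun e => ¬ Touches φ (S \ insert v S') e with hN
      obtain ⟨N', hN'sub, hN'card⟩ := exists_subset_card_eq (min_le_right m #N)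
      have hN' : ∀ e ∈ N', (e ∈ F ∧ ((φ e).1 = v ∨ (φ e).2 = v)) ∧
          ¬ Touches φ (S \ insert v S') e := fun e he => by
        have := hN'sub he
        rwa [hN, mem_filter, ha, mem_filter] at this
      have hKv : ∀ e ∈ K, (φ e).1 ≠ v ∧ (φ e).2 ≠ v := by
        refine fun e he => ⟨fun h1 => hKS e he (Or.inl ?_), fun h1 => hKS e he (Or.inr ?_)⟩ <;>
        · rw [h1]
          exact mem_sdiff.2 ⟨hvS, hv⟩
      have hdisj : Disjoint K N' := disjoint_left.2 fun e he he' => by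
        rcases (hN' e he').1.2 with h1 | h1
        · exact (hKv e he).1 h1
        · exact (hKv e he).2 h1
      refine ⟨K ∪ N', hK.union_star (fun e he => hF e (hN' e he).1.1) (fun e he => (hN' e he).1.2)
        hKv (hN'card ▸ min_le_left _ _), union_subset hKsub fun e he =>
        mem_union_right _ (hN' e he).1.1, ?_, ?_⟩
      · intro e he
        rcases mem_union.1 he with h1 | h1
        · intro h2
          have hsub : S \ insert v S' ⊆ S \ S' := sdiff_subset_sdiff subset_rfl (subset_insert _ _)
          exact hKS e h1 (h2.imp (@hsub _) (@hsub _))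
        · exact (hN' e h1).2
      · have h1 : #(a.filter fun e => Touches φ (S \ insert v S') e) + #N = degree φ F v :=
          card_filter_add_card_filter_not (s := a) _
        -- The edges of `F` at `v` excluded from `N` lead to unprocessed vertices. They are charged
        -- to `inside φ F S`, once each, when their first end is processed.
        have h2 : #((inside φ F S).filter (Touches φ S')) +
            #(a.filter fun e => Touches φ (S \ insert v S') e) ≤
            #((inside φ F S).filter (Touches φ (insert v S'))) := by
          rw [← card_union_of_disjoint]
          · refine card_le_card (union_subset (fun e he => ?_) fun e he => ?_)
            · rw [mem_filter] at he ⊢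
              exact ⟨he.1, he.2.imp (mem_insert_of_mem ·) (mem_insert_of_mem ·)⟩
            · simp only [ha, mem_filter, Touches, mem_sdiff, mem_insert, mem_inside] at he ⊢
              obtain ⟨⟨h3, h4⟩, h5⟩ := he
              rcases h4 with h4 | h4 <;> rcases h5 with h5 | h5 <;> subst h4 <;> tauto
          · refine disjoint_left.2 fun e he he' => ?_
            simp only [ha, mem_filter, Touches, mem_sdiff, mem_insert] at he he'
            obtain ⟨⟨-, h4⟩, h5⟩ := he'
            rcases h4 with h4 | h4 <;> subst h4 <;> tauto
        rw [sum_insert hv, card_union_of_disjoint hdisj, hN'card]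
        lia
  obtain ⟨K, hK, hKsub, -, hle⟩ := key S subset_rfl
  exact ⟨K, hK, hKsub, hle.trans (Nat.add_le_add_left (card_le_card (filter_subset _ _)) _)⟩

/-- The rank bound that a barrier gives for the edges avoiding it. -/
lemma IsBaseOver.card_add_le (hm : 0 < m) (hT : IsBaseOver φ m E F V T)
    (hspan : ∀ e ∈ E, ¬ Touches φ S e →
      e ∈ keep φ F S T ∨ Joined φ m (keep φ F S T) (φ e).1 (φ e).2)
    (hI : Sparse φ m I) (hIE : I ⊆ E) (hIS : ∀ e ∈ I, ¬ Touches φ S e) :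
    #I + ∑ v ∈ S, min m (degree φ F v) + ∑ v ∈ S, degree φ T v
      ≤ #T + ∑ v ∈ S, degree φ F v + #(inside φ T S) := by
  have hloop : ∀ e ∈ T, (φ e).1 ≠ (φ e).2 := fun e he => hT.sparse.fst_ne_snd he
  obtain ⟨K, hK, hKsub, hle⟩ := hI.exists_extension hIS fun e he => hloop e (hT.superset he)
  -- The barrier makes the kept edges span everything that avoids `S`, and they contain `F`; hence
  -- no sparse set built from such edges is larger.
  have h1 : #K ≤ #(keep φ F S T) := by
    refine (hT.sparse.mono keep_subset).card_le_of_spanned hm hK fun e he => ?_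
    rcases mem_union.1 (hKsub he) with h2 | h2
    · exact hspan e (hIE h2) (hIS e h2)
    · exact Or.inl (mem_keep.2 ⟨hT.superset h2, Or.inl h2⟩)
  have h2 : #(keep φ F S T) + #(touching φ T S) = #T + #(touching φ F S) := by
    rw [← card_union_add_card_inter]
    congr 2
    · ext e
      simp only [mem_union, mem_keep, mem_touching]
      by_cases h' : Touches φ S e <;> simp +contextual [h']
    · ext e
      have := @hT.superset e
      simp only [mem_inter, mem_keep, mem_touching]
      tauto
  have h3 := sum_degree hloop S
  have h4 := sum_degree (fun e he => hloop e (hT.superset he)) S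
  lia

/-- In a tight set with at least two vertices all degrees are at least `m`. -/
lemma Tight.le_degree (hI : Sparse φ m I) (hA : Tight φ m I A) (hx : x ∈ A) (hy : y ∈ A)
    (hxy : x ≠ y) : m ≤ degree φ I x := by
  have hsub : inside φ I A ⊆ inside φ I (A.erase x) ∪
      I.filter fun e => (φ e).1 = x ∨ (φ e).2 = x := by
    intro e he
    simp only [mem_union, mem_filter, mem_inside, mem_erase] at he ⊢
    tauto
  have h1 := (card_le_card hsub).trans (card_union_le _ _)
  have h2 := hI (A.erase x) ⟨y, mem_erase.2 ⟨hxy.symm, hy⟩⟩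
  have h3 := card_erase_add_one hx
  have h4 := hA.2
  rw [← h3, Nat.mul_add] at h4
  unfold degree
  lia

/-! ### Translation to `Graph` -/

/-- `φ` lists the two ends of each edge of `G`. -/
def ListsEnds (G : Graph α β) (φ : β → α × α) : Prop :=
  ∀ e ∈ E(G), G.IsLink e (φ e).1 (φ e).2

lemma exists_listsEnds (G : Graph α β) [Nonempty α] : ∃ φ, ListsEnds G φ := by
  have : ∀ e, ∃ p : α × α, e ∈ E(G) → G.IsLink e p.1 p.2 := by
    intro e
    by_cases he : e ∈ E(G)
    · obtain ⟨x, y, h⟩ := G.exists_isLink_of_mem_edgeSet he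
      exact ⟨(x, y), fun _ => h⟩
    · exact ⟨Classical.arbitrary _, fun h => absurd h he⟩
  choose φ hφ using this
  exact ⟨φ, hφ⟩

lemma ListsEnds.mono (hG : ListsEnds G φ) (h : H ≤ G) : ListsEnds H φ :=
  fun e he => (h.isLink_iff he).2 (hG e (h.edgeSet_mono he))

lemma ListsEnds.on (hG : ListsEnds G φ) (hV : V(G) = V) (hE : (E : Set β) ⊆ E(G)) :
    On φ V E := fun e he => by
  have h := hG e (hE he)
  exact ⟨mem_coe.1 (hV ▸ h.left_mem), mem_coe.1 (hV ▸ h.right_mem)⟩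

lemma ListsEnds.connects (hG : ListsEnds G φ) (hc : G.IsConnected) (hV : V(G) = V)
    (hE : E(G) = E) : Connects φ E V := by
  have hmem : ∀ x, x ∈ V(G) ↔ x ∈ V := fun x => by rw [hV, mem_coe]
  refine ⟨hc.1.imp fun x hx => (hmem x).1 hx, fun W x hx hxW hW y hy => ?_⟩
  have hr := hc.2 x ((hmem x).2 hx) y ((hmem y).2 hy)
  clear hy
  induction hr with
  | refl => exact hxW
  | @tail u v _ huv ih =>
    obtain ⟨e, he⟩ := huv
    have h1 := hG e he.edge_mem
    have h2 : e ∈ inside φ E V := mem_inside.2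
      ⟨mem_coe.1 (hE ▸ he.edge_mem), (hmem _).1 h1.left_mem, (hmem _).1 h1.right_mem⟩
    rcases h1.eq_and_eq_or_eq_and_eq he with ⟨h3, h4⟩ | ⟨h3, h4⟩
    · rw [← h4, ← hW e h2, h3]
      exact ih
    · rw [← h3, hW e h2, h4]
      exact ih

lemma ListsEnds.exists_connects (hG : ListsEnds G φ) (ht : G.IsTreeConnected m) (hV : V(G) = V)
    (hE : E(G) = E) : ∃ P : Fin m → Finset β, (∀ i, P i ⊆ E) ∧
      (∀ i j, i ≠ j → Disjoint (P i) (P j)) ∧ ∀ i, Connects φ (P i) V := by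
  obtain ⟨T, hT, hdisj⟩ := ht
  have hfin : ∀ i, ∃ P : Finset β, E(T i) = P := fun i =>
    (E.finite_toSet.subset (hE ▸ (hT i).1.le.edgeSet_mono)).exists_finset_coe.imp
      fun _ h => h.symm
  choose P hP using hfin
  refine ⟨P, fun i => ?_, fun i j hij => ?_, fun i => ?_⟩
  · rw [← coe_subset, ← hP, ← hE]
    exact (hT i).1.le.edgeSet_mono
  · have := hdisj i j hij
    rwa [hP, hP, disjoint_coe] at this
  · exact (hG.mono (hT i).1.le).connects (hT i).2.1 ((hT i).1.vertexSet_eq.trans hV) (hP i)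

lemma ListsEnds.isConnected (hG : ListsEnds G φ) (hV : V(G) = V) (hE : (E : Set β) ⊆ E(G))
    (hc : Connects φ E V) : G.IsConnected := by
  classical
  have hmem : ∀ x, x ∈ V(G) ↔ x ∈ V := fun x => by rw [hV, mem_coe]
  refine ⟨hc.1.imp fun x hx => (hmem x).2 hx, fun x hx y hy => ?_⟩
  have h1 := hc.2 (V.filter (Relation.ReflTransGen G.Adj x)) x ((hmem x).1 hx)
    (mem_filter.2 ⟨(hmem x).1 hx, .refl⟩) fun e he => by
      rw [mem_inside] at he
      have h2 := (hG e (hE he.1)).adj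
      simp only [mem_filter, he.2, true_and]
      exact ⟨fun h => h.tail h2, fun h => h.tail h2.symm⟩
  exact (mem_filter.1 (h1 ((hmem y).1 hy))).2

/-- A cycle has as many edges as vertices, one too many for a `1`-sparse set. -/
lemma ListsEnds.not_hasCycle (hG : ListsEnds G φ) (hE : E(G) = E) (hs : Sparse φ 1 E) :
    ¬ G.HasCycle := by
  rintro ⟨n, v, e, hv, he, hlink⟩
  have h1 := hs (univ.image v) (univ_nonempty.image v)
  have h2 : univ.image e ⊆ inside φ E (univ.image v) := by
    intro f hf
    obtain ⟨i, -, rfl⟩ := mem_image.1 hf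
    have h3 := hG _ (hlink i).edge_mem
    have h4 : ∀ j, v j ∈ univ.image v := fun j => mem_image_of_mem v (mem_univ j)
    refine mem_inside.2 ⟨mem_coe.1 (hE ▸ (hlink i).edge_mem), ?_⟩
    rcases h3.eq_and_eq_or_eq_and_eq (hlink i) with ⟨h5, h6⟩ | ⟨h5, h6⟩ <;>
    · rw [h5, h6]
      exact ⟨h4 _, h4 _⟩
  have h3 := card_le_card h2
  rw [card_image_of_injective _ he, card_univ, Fintype.card_fin] at h3
  rw [card_image_of_injective _ hv, card_univ, Fintype.card_fin] at h1
  lia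

lemma restrict_isSpanningSubgraph (G : Graph α β) (E₀ : Set β) : G.restrict E₀ ≤s G :=
  ⟨Graph.restrict_le, rfl⟩

lemma edgeSet_restrict_of_subset {E₀ : Set β} (h : E₀ ⊆ E(G)) : E(G.restrict E₀) = E₀ := by
  simpa using h

/-- A graph with an `m`-sparse edge set for which the vertex set is tight is
`m`-tree-connected. -/
lemma ListsEnds.isTreeConnected (hm : 0 < m) (hG : ListsEnds G φ) (hV : V(G) = V)
    (hI : (I : Set β) ⊆ E(G)) (hs : Sparse φ m I) (ht : Tight φ m I V) :
    G.IsTreeConnected m := by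
  obtain ⟨P, hP, hcov⟩ := hs.exists_forestPacking hm
  have hPE : ∀ i, E(G.restrict (P i : Set β)) = P i := fun i =>
    edgeSet_restrict_of_subset ((coe_subset.2 (hP.subset i)).trans hI)
  have hends : ∀ i, ListsEnds (G.restrict (P i : Set β)) φ := fun i =>
    hG.mono Graph.restrict_le
  refine ⟨fun i => G.restrict (P i : Set β), fun i =>
    ⟨restrict_isSpanningSubgraph _ _, ?_, ?_⟩, fun i j hij => ?_⟩
  · exact (hends i).isConnected hV (hPE i).ge
      ((hP.tight hcov ht i).connects one_pos (hP.sparse i))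
  · exact (hends i).not_hasCycle (hPE i) (hP.sparse i)
  · rw [hPE, hPE, disjoint_coe]
    exact hP.disjoint i j hij

lemma ListsEnds.edgeSet_induce_eq (hG : ListsEnds G φ) (hE : E(G) = E) (A : Finset α) :
    E(G.induce (A : Set α)) = inside φ E A := by
  ext e
  rw [Graph.edgeSet_induce, mem_coe, mem_inside, ← mem_coe, ← hE]
  constructor
  · rintro ⟨x, y, hl, hx, hy⟩
    refine ⟨hl.edge_mem, ?_⟩
    rcases (hG e hl.edge_mem).eq_and_eq_or_eq_and_eq hl with ⟨h1, h2⟩ | ⟨h1, h2⟩ <;>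
    · rw [h1, h2]
      exact ⟨by assumption, by assumption⟩
  · rintro ⟨he, h1, h2⟩
    exact ⟨_, _, hG e he, h1, h2⟩

/-- The `m`-tree-connected components of a graph are the maximal tight sets of a maximal sparse
set of its edges. -/
lemma ListsEnds.treeComponents_eq (hm : 0 < m) (hG : ListsEnds G φ) (hV : V(G) = V)
    (hE : E(G) = E) (hIE : I ⊆ E) (hs : Sparse φ m I)
    (hspan : ∀ e ∈ E, e ∈ I ∨ Joined φ m I (φ e).1 (φ e).2) :
    G.treeComponents m = ((↑) : Finset α → Set α) '' (components φ m I V : Set (Finset α)) := by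
  have hIV : On φ V I := hG.on hV (hE ▸ coe_subset.2 hIE)
  have hAV : ∀ A ∈ components φ m I V, A ⊆ V := by
    intro A hA x hx
    obtain ⟨y, -, rfl⟩ := mem_image.1 hA
    exact (mem_component.1 hx).1
  have h1 : ∀ B : Set α, B ⊆ V(G) → (G.induce B).IsTreeConnected m →
      ∃ A ∈ components φ m I V, B ⊆ A := by
    intro B hB ht
    obtain ⟨B, rfl⟩ := (V.finite_toSet.subset (hV ▸ hB)).exists_finset_coe
    have hBV : B ⊆ V := coe_subset.1 (hV ▸ hB)
    obtain ⟨P, hPE, hdisj, hconn⟩ := (hG.mono (Graph.induce_le hB)).exists_connects ht rfl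
      (hG.edgeSet_induce_eq hE B)
    obtain ⟨A, hA, hBA⟩ := hs.exists_tight_superset hm hIV hspan hBV
      (fun i => (hPE i).trans inside_subset) hdisj hconn
    obtain ⟨x, hx⟩ := (hconn ⟨0, hm⟩).1
    exact ⟨component φ m I V x, mem_image_of_mem _ (hBV hx), fun y hy =>
      mem_component.2 ⟨hBV hy, A, hA, hBA hx, hBA hy⟩⟩
  have h2 : ∀ A ∈ components φ m I V, (A : Set α) ⊆ V(G) ∧
      (G.induce (A : Set α)).IsTreeConnected m := by
    intro A hA
    have hAV' : (A : Set α) ⊆ V(G) := hV ▸ coe_subset.2 (hAV A hA)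
    refine ⟨hAV', ?_⟩
    have hAt := hs.tight_of_mem_components hm hIV hA
    refine (hG.mono (Graph.induce_le hAV')).isTreeConnected hm (I := inside φ I A) rfl ?_
      (hs.mono inside_subset) ⟨hAt.1, ?_⟩
    · rw [hG.edgeSet_induce_eq hE A]
      exact coe_subset.2 (inside_mono hIE subset_rfl)
    · rw [← hAt.2]
      congr 2
      ext e
      simp only [mem_inside]
      tauto
  ext B
  simp only [Graph.treeComponents, Set.mem_ofPred_eq, Set.mem_image, mem_coe]
  constructor
  · intro hB
    obtain ⟨A, hA, hBA⟩ := h1 B hB.1.1 hB.1.2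
    exact ⟨A, hA, (hB.2 (h2 A hA) hBA).antisymm hBA⟩
  · rintro ⟨A, hA, rfl⟩
    refine ⟨h2 A hA, fun B hB hAB => ?_⟩
    obtain ⟨A', hA', hBA'⟩ := h1 B hB.1 hB.2
    obtain ⟨x, hx⟩ := (hs.tight_of_mem_components hm hIV hA).1
    have hxA' : x ∈ A' := mem_coe.1 (hBA' (hAB (mem_coe.2 hx)))
    have hxV := hAV A hA hx
    rw [hs.mem_iff_component_eq hA hxV] at hx
    rw [hs.mem_iff_component_eq hA' hxV] at hxA'
    rw [← hx, hxA']
    exact hBA'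

/-- An edge between different components is not spanned by `I`, so maximality puts it in `I`.
Counting within `I` therefore gives `e_G(P)`. -/
lemma ListsEnds.crossingEdges_eq (hm : 0 < m) (hG : ListsEnds G φ) (hV : V(G) = V)
    (hE : E(G) = E) (hIE : I ⊆ E) (hs : Sparse φ m I)
    (hspan : ∀ e ∈ E, e ∈ I ∨ Joined φ m I (φ e).1 (φ e).2) :
    G.crossingEdges (G.treeComponents m) = crossing φ m I I := by
  rw [hG.treeComponents_eq hm hV hE hIE hs hspan]
  have hEV : On φ V E := hG.on hV hE.ge
  ext e
  simp only [Graph.crossingEdges, Set.mem_ofPred_eq, Set.mem_image, mem_coe,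
    exists_exists_and_eq_and, mem_crossing]
  constructor
  · rintro ⟨x, y, hl, A, hA, B, hB, hAB, hx, hy⟩
    have heE : e ∈ E := mem_coe.1 (hE ▸ hl.edge_mem)
    have hnj : ¬ Joined φ m I (φ e).1 (φ e).2 := by
      intro hj
      have hj' : Joined φ m I x y := by
        rcases (hG e hl.edge_mem).eq_and_eq_or_eq_and_eq hl with ⟨h1, h2⟩ | ⟨h1, h2⟩
        · rwa [h1, h2] at hj
        · rw [h1, h2] at hj
          exact hj.symm
      have hxV : x ∈ V := mem_coe.1 (hV ▸ hl.left_mem)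
      have hyV : y ∈ V := mem_coe.1 (hV ▸ hl.right_mem)
      rw [hs.mem_iff_component_eq hA hxV] at hx
      rw [hs.mem_iff_component_eq hB hyV] at hy
      exact hAB (by rw [← hx, ← hy, (hs.component_eq_iff hyV).2 hj'])
    exact ⟨(hspan e heE).resolve_right hnj, hnj⟩
  · rintro ⟨heI, hnj⟩
    have hends := hEV e (hIE heI)
    refine ⟨_, _, hG e (hE ▸ mem_coe.2 (hIE heI)), component φ m I V (φ e).1,
      mem_image_of_mem _ hends.1, component φ m I V (φ e).2, mem_image_of_mem _ hends.2,
      fun heq => hnj ((hs.component_eq_iff hends.2).1 (coe_injective heq)),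
      hs.self_mem_component hends.1, hs.self_mem_component hends.2⟩

/-- The tree-connectivity measure in terms of the size of a maximal sparse edge set. -/
lemma ListsEnds.mul_treeMeasure_eq (hm : 0 < m) (hG : ListsEnds G φ) (hV : V(G) = V)
    (hE : E(G) = E) (hIE : I ⊆ E) (hs : Sparse φ m I)
    (hspan : ∀ e ∈ E, e ∈ I ∨ Joined φ m I (φ e).1 (φ e).2) :
    (m : ℝ) * G.treeMeasure m = m * #V - #I := by
  have hIV : On φ V I := hG.on hV (hE ▸ coe_subset.2 hIE)
  have h1 := hs.card_add hm hIV
  unfold Graph.treeMeasure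
  rw [hG.crossingEdges_eq hm hV hE hIE hs hspan, hG.treeComponents_eq hm hV hE hIE hs hspan,
    Set.ncard_image_of_injective _ coe_injective, Set.ncard_coe_finset, Set.ncard_coe_finset]
  have hm' : (m : ℝ) ≠ 0 := by positivity
  have h2 : (#I : ℝ) + m * #(components φ m I V) = m * #V + #(crossing φ m I I) := by
    exact_mod_cast h1
  field_simp
  linarith

lemma ListsEnds.deg_eq (hG : ListsEnds G φ) (hE : E(G) = E) (v : α) :
    G.deg v = degree φ E v := by
  unfold Graph.deg degree
  rw [← Set.ncard_coe_finset]
  congr 1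
  ext e
  rw [Graph.mem_incidenceSet, mem_coe, mem_filter, ← mem_coe, ← hE]
  constructor
  · intro h
    exact ⟨h.edge_mem, (h.eq_or_eq_of_isLink (hG e h.edge_mem)).imp Eq.symm Eq.symm⟩
  · rintro ⟨he, rfl | rfl⟩
    · exact (hG e he).inc_left
    · exact (hG e he).inc_right

lemma ListsEnds.numEdgesInside_eq (hG : ListsEnds G φ) (hE : E(G) = E) (S : Finset α) :
    G.numEdgesInside (S : Set α) = #(inside φ E S) := by
  unfold Graph.numEdgesInside
  rw [← Set.ncard_coe_finset, ← hG.edgeSet_induce_eq hE S, Graph.edgeSet_induce]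
  congr 1
  ext e
  constructor
  · rintro ⟨x, hx, y, hy, h⟩
    exact ⟨x, y, h, hx, hy⟩
  · rintro ⟨x, y, h, hx, hy⟩
    exact ⟨x, hx, y, hy, h⟩

lemma ListsEnds.edgeSet_deleteVerts_eq (hG : ListsEnds G φ) (hE : E(G) = E) (S : Finset α) :
    E(G.deleteVerts (S : Set α)) = (E \ touching φ E S : Finset β) := by
  ext e
  rw [Graph.edgeSet_deleteVerts, mem_coe, mem_sdiff, mem_touching, ← mem_coe, ← hE]
  constructor
  · rintro ⟨x, y, hl, hx, hy⟩
    refine ⟨hl.edge_mem, fun h => ?_⟩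
    rcases (hG e hl.edge_mem).eq_and_eq_or_eq_and_eq hl with ⟨h1, h2⟩ | ⟨h1, h2⟩ <;>
    · have h3 := h.2
      rw [Touches, h1, h2] at h3
      rw [mem_coe] at hx hy
      tauto
  · rintro ⟨he, h⟩
    exact ⟨_, _, hG e he, fun h' => h ⟨he, Or.inl h'⟩, fun h' => h ⟨he, Or.inr h'⟩⟩

/-! ### The final inequality and the assembly -/

/-- The inequality that a barrier yields contradicts the hypothesis on the tree-connectivity
measure. -/
lemma barrier_inequality_absurd {m n k a t i g lam Ω ση : ℝ}
    (hm : 0 < m) (hlam : 0 ≤ lam) (hlam' : lam * m ≤ 1) (ht : t + m = m * n)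
    (ha : a + (k * (-(m ^ 2 * lam)) + m * ση) + 1 ≤ t + i)
    (hi : i + m ≤ m * k) (hig : i ≤ g) (hΩ : m * Ω = m * (n - k) - a)
    (hlt : Ω < 1 / m + (ση - 2 * k) + 2 - lam * (g + m)) : False := by
  have h1 : m * Ω < m * (1 / m + (ση - 2 * k) + 2 - lam * (g + m)) :=
    mul_lt_mul_of_pos_left hlt hm
  have h2 : m * (1 / m + (ση - 2 * k) + 2 - lam * (g + m))
      = 1 + m * ση - 2 * m * k + 2 * m - lam * m * g - lam * m * m := by
    field_simp
    ring
  -- Put `x = m * k - m - i ≥ 0`. The hypotheses combine to `x < lam * m * (m * k - m - g)`, while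
  -- `i ≤ g` and `lam * m ≤ 1` bound the right side by `lam * m * x ≤ x`.
  have h3 : 0 ≤ (1 - lam * m) * (m * k - m - i) :=
    mul_nonneg (by linarith) (by linarith)
  have h4 : 0 ≤ lam * m * (g - i) := mul_nonneg (by positivity) (by linarith)
  nlinarith

/-- In an `m`-tree-connected graph each sparse edge set extends to a base. -/
lemma ListsEnds.exists_isBaseOver (hm : 0 < m) (hG : ListsEnds G φ) (ht : G.IsTreeConnected m)
    (hV : V(G) = V) (hE : E(G) = E) (hF : Sparse φ m F) (hFE : F ⊆ E) :
    ∃ T, IsBaseOver φ m E F V T := by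
  obtain ⟨T, hFT, hTE, hT, hspan⟩ := hF.exists_spanning hFE
  obtain ⟨P, hPE, hdisj, hconn⟩ := hG.exists_connects ht hV hE
  have hTV : On φ V T := hG.on hV (hE ▸ coe_subset.2 hTE)
  obtain ⟨A, hA, hVA⟩ := hT.exists_tight_superset hm hTV hspan subset_rfl hPE hdisj hconn
  obtain ⟨x, hx⟩ := (hconn ⟨0, hm⟩).1
  have hAV := hA.subset_of_on hm hT hTV (hVA hx) hx
  exact ⟨T, hTE, hFT, hT, hVA.antisymm hAV ▸ hA⟩

/-- Adding back the edges of `F` to a base over a maximal sparse subset `F₀` of `F`. -/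
lemma degree_union_le {F₀ : Finset β} (hF₀ : Sparse φ m F₀) (hF₀F : F₀ ⊆ F) (hF₀T : F₀ ⊆ T)
    (hspan : ∀ e ∈ F, e ∈ F₀ ∨ Joined φ m F₀ (φ e).1 (φ e).2)
    (hloop : ∀ e ∈ F, (φ e).1 ≠ (φ e).2) (c : ℤ)
    (hv : (degree φ T v : ℤ) ≤ c + max 0 ((degree φ F₀ v : ℤ) - m)) :
    (degree φ (T ∪ F) v : ℤ) ≤ c + max 0 ((degree φ F v : ℤ) - m) := by
  have h1 : degree φ (T ∪ F) v + degree φ F₀ v ≤ degree φ T v + degree φ F v := by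
    unfold degree
    rw [filter_union, ← card_union_add_card_inter (T.filter _)]
    refine Nat.add_le_add_left (card_le_card (subset_inter ?_ ?_)) _
    · exact filter_subset_filter _ hF₀T
    · exact filter_subset_filter _ hF₀F
  -- If `F` has an edge at `v` outside `F₀`, then `v` lies in a tight set of `F₀` with at least two
  -- vertices, so `d_{F₀}(v) ≥ m`. Both maxima are then plain differences, and the allowance grows
  -- by exactly `d_F(v) - d_{F₀}(v)`.
  by_cases h : ∀ e ∈ F, (φ e).1 = v ∨ (φ e).2 = v → e ∈ F₀
  · have h2 : degree φ F₀ v = degree φ F v :=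
      degree_congr fun e he => ⟨fun h' => hF₀F h', fun h' => h e h' he⟩
    rw [h2] at h1 hv
    lia
  · push Not at h
    obtain ⟨e, he, hev, heF₀⟩ := h
    obtain ⟨A, hA, h2, h3⟩ := (hspan e he).resolve_left heF₀
    have h4 : m ≤ degree φ F₀ v := by
      rcases hev with rfl | rfl
      · exact hA.le_degree hF₀ h2 h3 (hloop e he)
      · exact hA.le_degree hF₀ h3 h2 (hloop e he).symm
    lia

end EdgeSparsity

open EdgeSparsity in
theorem mainTheorem9 {α β : Type*} (m : ℕ) (hm : 0 < m)
    (G : Graph α β) [G.Loopless] (hVfin : V(G).Finite) (hEfin : E(G).Finite)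
    (hG : G.IsTreeConnected m)
    (X : Set α) (hX : X ⊆ V(G))
    (F : Graph α β) (hF : F ≤s G)
    (lam : ℝ) (hlam : lam ∈ Set.Icc (0 : ℝ) (1 / (m : ℝ)))
    (η : α → ℝ) (hη : ∀ v ∈ X, (m : ℝ) * lam + ((m : ℝ) - 1) / (m : ℝ) < η v)
    (hΩ : ∀ S : Finset α, (S : Set α) ⊆ X →
      (G.deleteVerts (S : Set α)).treeMeasure m
        < 1 / (m : ℝ) + ∑ v ∈ S, (η v - 2) + 2
          - lam * ((G.numEdgesInside (S : Set α) : ℝ) + (m : ℝ))) :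
    ∃ H : Graph α β, H ≤s G ∧ F ≤s H ∧ H.IsTreeConnected m ∧
      ∀ v ∈ X, (H.deg v : ℤ)
        ≤ ⌈(m : ℝ) * η v - (m : ℝ) ^ 2 * lam⌉ + max 0 ((F.deg v : ℤ) - (m : ℤ)) := by
  classical
  obtain ⟨V, hV⟩ : ∃ V : Finset α, V(G) = V := hVfin.exists_finset_coe.imp fun _ h => h.symm
  obtain ⟨E, hE⟩ : ∃ E : Finset β, E(G) = E := hEfin.exists_finset_coe.imp fun _ h => h.symm
  obtain ⟨X, rfl⟩ := (hVfin.subset hX).exists_finset_coe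
  obtain ⟨FE, hFE⟩ : ∃ FE : Finset β, E(F) = FE :=
    (hEfin.subset hF.le.edgeSet_mono).exists_finset_coe.imp fun _ h => h.symm
  have hFEE : FE ⊆ E := by
    rw [← Finset.coe_subset, ← hFE, ← hE]
    exact hF.le.edgeSet_mono
  have hne : V(G).Nonempty := by
    obtain ⟨T, hT, -⟩ := hG
    rw [← (hT ⟨0, hm⟩).1.vertexSet_eq]
    exact (hT ⟨0, hm⟩).2.1.1
  have : Nonempty α := hne.nonempty
  obtain ⟨φ, hφ⟩ := exists_listsEnds G
  have hEV : On φ V E := hφ.on hV hE.ge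
  have hloop : ∀ e ∈ E, (φ e).1 ≠ (φ e).2 := fun e he =>
    (hφ e (hE ▸ Finset.mem_coe.2 he)).ne
  -- `F` need not be sparse, so only a maximal sparse part of it can be contained in a base.
  obtain ⟨F₀, -, hF₀F, hF₀, hF₀span⟩ := (sparse_empty φ m).exists_spanning (Finset.empty_subset FE)
  obtain ⟨T₀, hT₀⟩ := hφ.exists_isBaseOver hm hG hV hE hF₀ (hF₀F.trans hFEE)
  set h : α → ℤ := fun v =>
    ⌈(m : ℝ) * η v - (m : ℝ) ^ 2 * lam⌉ + max 0 ((degree φ F₀ v : ℤ) - (m : ℤ)) with hdef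
  by_cases hno : ∀ T, IsBaseOver φ m E F₀ V T → ∃ v ∈ X, h v < degree φ T v
  · exfalso
    obtain ⟨T, S, hT, hSX, hSle, ⟨v₀, hv₀, hlt⟩, hspan⟩ := exists_barrier hm hEV h hT₀ hno
    have hSV : S ⊆ V := hSX.trans (Finset.coe_subset.1 (hV ▸ hX))
    obtain ⟨I, -, hIE, hI, hIspan⟩ :=
      (sparse_empty φ m).exists_spanning (Finset.empty_subset (E \ touching φ E S))
    have hIS : ∀ e ∈ I, ¬ Touches φ S e := fun e he hS => by
      have h1 := Finset.mem_sdiff.1 (hIE he)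
      exact h1.2 (mem_touching.2 ⟨h1.1, hS⟩)
    have hrank := hT.card_add_le hm hspan hI (hIE.trans Finset.sdiff_subset) hIS
    have hVd : V(G.deleteVerts (S : Set α)) = (V \ S : Finset α) := by
      rw [Graph.vertexSet_deleteVerts, hV, Finset.coe_sdiff]
    have hmeasure := (hφ.mono Graph.deleteVerts_le).mul_treeMeasure_eq hm hVd
      (hφ.edgeSet_deleteVerts_eq hE S) hIE hI hIspan
    have hΩS := hΩ S (Finset.coe_subset.2 hSX)
    rw [hφ.numEdgesInside_eq hE S, Finset.sum_sub_distrib, Finset.sum_const, nsmul_eq_mul,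
      mul_comm _ (2 : ℝ)] at hΩS
    rw [Finset.cast_card_sdiff hSV] at hmeasure
    -- Degrees and bounds are integers, so the one overloaded vertex gains a full unit; it matches
    -- the term `1 / m` of the hypothesis multiplied by `m`.
    have hsum : ∑ v ∈ S, h v + 1 ≤ ∑ v ∈ S, (degree φ T v : ℤ) :=
      Int.add_one_le_of_lt (Finset.sum_lt_sum hSle ⟨v₀, hv₀, hlt⟩)
    have hhle : ∀ v, ((m : ℝ) * η v - (m : ℝ) ^ 2 * lam) +
        ((degree φ F₀ v : ℝ) - (min m (degree φ F₀ v) : ℕ)) ≤ h v := by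
      intro v
      -- The form in which the rank bound `hrank` contains the degrees of `F₀`.
      have h1 : max 0 ((degree φ F₀ v : ℤ) - (m : ℤ))
          = (degree φ F₀ v : ℤ) - (min m (degree φ F₀ v) : ℕ) := by lia
      rw [hdef]
      simp only [h1]
      push_cast
      have := Int.le_ceil ((m : ℝ) * η v - (m : ℝ) ^ 2 * lam)
      linarith
    have hsum' := Finset.sum_le_sum fun v (_ : v ∈ S) => hhle v
    rw [Finset.sum_add_distrib, Finset.sum_sub_distrib, Finset.sum_sub_distrib, Finset.sum_const,
      nsmul_eq_mul, ← Finset.mul_sum] at hsum'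
    have hsumR : (∑ v ∈ S, (h v : ℝ)) + 1 ≤ ∑ v ∈ S, (degree φ T v : ℝ) := by exact_mod_cast hsum
    have hrankR : (I.card : ℝ) + ∑ v ∈ S, ((min m (degree φ F₀ v) : ℕ) : ℝ) +
        ∑ v ∈ S, (degree φ T v : ℝ) ≤ T.card + ∑ v ∈ S, (degree φ F₀ v : ℝ) +
          (inside φ T S).card := by exact_mod_cast hrank
    have hcard : (T.card : ℝ) + m = m * V.card := by exact_mod_cast hT.card hEV
    -- Sparsity applies because the overloaded vertex `v₀` makes `S` nonempty.
    have hins : ((inside φ T S).card : ℝ) + m ≤ m * S.card := by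
      exact_mod_cast hT.sparse S ⟨v₀, hv₀⟩
    have hins' : ((inside φ T S).card : ℝ) ≤ (inside φ E S).card := by
      exact_mod_cast Finset.card_le_card (inside_mono (φ := φ) hT.subset (Finset.Subset.refl S))
    have hm' : (0 : ℝ) < m := by exact_mod_cast hm
    exact barrier_inequality_absurd hm' hlam.1 ((le_div_iff₀ hm').1 hlam.2) hcard (by linarith)
      hins hins' hmeasure hΩS
  · push Not at hno
    obtain ⟨T, hT, hdeg⟩ := hno
    have hsub : ((T ∪ FE : Finset β) : Set β) ⊆ E(G) :=
      hE ▸ Finset.coe_subset.2 (Finset.union_subset hT.subset hFEE)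
    have hHE := edgeSet_restrict_of_subset hsub
    have hH := hφ.mono (Graph.restrict_le (E₀ := ((T ∪ FE : Finset β) : Set β)))
    refine ⟨G.restrict ((T ∪ FE : Finset β) : Set β), restrict_isSpanningSubgraph _ _,
      ⟨⟨hF.vertexSet_eq.le, fun e x y hl => ⟨?_, hF.le.isLink_mono hl⟩⟩, hF.vertexSet_eq⟩, ?_,
      fun v hv => ?_⟩
    · exact Finset.mem_coe.2 (Finset.mem_union_right _
        (Finset.mem_coe.1 (hFE ▸ hl.edge_mem)))
    · refine hH.isTreeConnected hm (V := V) hV ?_ hT.sparse hT.tight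
      rw [hHE]
      exact Finset.coe_subset.2 Finset.subset_union_left
    · rw [hH.deg_eq hHE, (hφ.mono hF.le).deg_eq hFE]
      exact degree_union_le hF₀ hF₀F hT.superset hF₀span (fun e he => hloop e (hFEE he)) _
        (hdeg v hv)
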